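/- Let $T>0$ and let $H$ be the Heaviside function, $H(t)=1$ for $t\ge 0$ and $H(t)=0$ for $t<0$. Then there is a constant $C>0$, depending only on $T$, such that the following holds. Let $\varphi\in C_c^\infty(\mathbb{R})$ be real-valued with $\varphi\ge 0$ and $\int_{\mathbb{R}}\varphi=1$, and for $\varepsilon\in(0,1]$ put $\varphi_\varepsilon(t)=\varepsilon^{-1}\varphi(t/\varepsilon)$ and $H_\varepsilon=H*\varphi_\varepsilon$. Let $g_0,g_1\in C_c^\infty(\mathbb{R})$ be complex-valued. Then for every $\varepsilon\in(0,1]$ the Cauchy problem $$\partial_t^2u_\varepsilon(t,x)-H_\varepsilon(t-1)\,\partial_x^2u_\varepsilon(t,x)=0,\quad (t,x)\in[0,T]\times\mathbb{R},\qquad u_\varepsilon(0,x)=g_0(x),\quad \partial_tu_\varepsilon(0,x)=g_1(x),$$ has exactly one classical solution $u_\varepsilon\in C^2([0,T]\times\mathbb{R})$, and $$\|u_\varepsilon(\tau,\cdot)\|^2_{H^2(\mathbb{R})}\le C\left(\|g_0\|^2_{H^5(\mathbb{R})}+\|g_1\|^2_{H^4(\mathbb{R})}\right)\qquad\text{for all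 }\tau\in[0,T],$$ where $\|f\|^2_{H^k(\mathbb{R})}=\sum_{j=0}^{k}\int_{\mathbb{R}}|f^{(j)}(x)|^2\,dx$. In particular $C$ is independent of $\varepsilon$. -/

import Mathlib

open scoped ContDiff

/-- The Heaviside function `H`, equal to `1` for `t ≥ 0` and to `0` for `t < 0`. -/
noncomputable def heavisideFn (t : ℝ) : ℝ := if 0 ≤ t then 1 else 0

/-- A nonnegative Friedrichs mollifier: `φ ∈ C_c^∞(ℝ)`, `φ ≥ 0` and `∫ φ = 1`. -/
structure IsNonnegMollifier (φ : ℝ → ℝ) : Prop where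
  smooth : ContDiff ℝ ∞ φ
  compactSupport : HasCompactSupport φ
  nonneg : ∀ t, 0 ≤ φ t
  integral_eq_one : ∫ t, φ t = 1

/-- The rescaled mollifier `φ_ε(t) = ε⁻¹ φ(t / ε)`. -/
noncomputable def scaledMollifier (φ : ℝ → ℝ) (ε : ℝ) (t : ℝ) : ℝ := 1 / ε * φ (t / ε)

/-- The regularised Heaviside function `H_ε = H * φ_ε`. -/
noncomputable def regHeaviside (φ : ℝ → ℝ) (ε : ℝ) : ℝ → ℝ :=
  MeasureTheory.convolution heavisideFn (scaledMollifier φ ε)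
    (ContinuousLinearMap.mul ℝ ℝ) MeasureTheory.volume

/-- The squared Sobolev norm `‖f‖²_{H^k(ℝ)} = ∑_{j ≤ k} ∫ |f^{(j)}(x)|² dx` of a `C^k` function `f`
(whose weak derivatives up to order `k` are the classical ones), with values in `[0, ∞]`; such an
`f` belongs to `H^k(ℝ)` exactly when this quantity is finite. -/
noncomputable def sobolevNormSq (k : ℕ) (f : ℝ → ℂ) : ENNReal :=
  ∑ j ∈ Finset.range (k + 1), ∫⁻ x, ‖iteratedDeriv j f x‖ₑ ^ 2

/-- `u` is a classical solution, of class `C²` on the closed strip `[0, T] × ℝ`, of the Cauchy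
problem `u_tt - H_ε(t - 1) u_xx = 0`, `u(0, ·) = g₀`, `u_t(0, ·) = g₁`. Time derivatives are taken
within `[0, T]`, hence are one-sided at the end points. -/
structure IsRegularisedSolution (T : ℝ) (φ : ℝ → ℝ) (ε : ℝ) (g₀ g₁ : ℝ → ℂ)
    (u : ℝ → ℝ → ℂ) : Prop where
  contDiffOn : ContDiffOn ℝ 2 (fun p : ℝ × ℝ => u p.1 p.2) (Set.Icc 0 T ×ˢ Set.univ)
  equation : ∀ t ∈ Set.Icc 0 T, ∀ x : ℝ,
    iteratedDerivWithin 2 (fun s => u s x) (Set.Icc 0 T) t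
      - (regHeaviside φ ε (t - 1) : ℂ) * iteratedDeriv 2 (u t) x = 0
  initial : ∀ x : ℝ, u 0 x = g₀ x
  initial_deriv : ∀ x : ℝ, derivWithin (fun s => u s x) (Set.Icc 0 T) 0 = g₁ x

open MeasureTheory Set Filter Topology
open scoped FourierTransform SchwartzMap

/-! Put a(t) = H_ε(t - 1). Since the mollifier is a probability density, a is a shifted distribution
function: smooth, nondecreasing, with values in [0, 1]. Only these properties enter the estimates,
so the constants cannot see ε.

Existence and bound: the Fourier transform in x turns the equation into y'' + k a(t) y = 0 with k =
(2πξ)². The energy F = |y'|² + (ka + 1)|y|² satisfies F' ≤ F + ka'|y|². Because a' ≥ 0, the last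
term is at most F times the logarithmic derivative of ka + 1, so e^{-t} F / (ka + 1) is
nonincreasing for t ≥ 0. The total loss is a factor at most 1 + k, however steep a is; this is one
derivative in x (`oscillator_energy_le`). Plancherel then gives the Sobolev bound
(`exists_wave_solution`).

Uniqueness is proved among all C² solutions, with no decay in x, hence by energy on backward cones
(`strip_space_deriv_eq_zero`). As a may vanish, the density is p²/(a + δ) + q² with p = w_t, q =
w_x. Monotonicity gives the derivative of 1/(a + δ) a favourable sign. The remaining error is δ ·
2|p q_x|/(a + δ), and integrating p_t = a q_x from zero data gives |p| ≤ C a, again by monotonicity.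
So the error is O(δ), and δ → 0 forces q = 0. -/

/-! ### Power series solution of the oscillator system, with continuity in the parameter -/

/-- Iterated primitives `Y₀ = 1`, `Yₙ₊₁(t) = ∫₀ᵗ cₙ Yₙ`. -/
noncomputable def iteratedPrimitive (c : ℕ → ℝ → ℝ) : ℕ → ℝ → ℝ
  | 0 => fun _ => 1
  | n + 1 => fun t => ∫ s in (0 : ℝ)..t, c n s * iteratedPrimitive c n s

theorem continuous_iteratedPrimitive {c : ℕ → ℝ → ℝ} (hc : ∀ n, Continuous (c n)) (n : ℕ) :
    Continuous (iteratedPrimitive c n) := by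
  induction n with
  | zero => exact continuous_const
  | succ n ih =>
    exact intervalIntegral.continuous_primitive
      (fun a b => ((hc n).mul ih).intervalIntegrable a b) 0

theorem hasDerivAt_iteratedPrimitive {c : ℕ → ℝ → ℝ} (hc : ∀ n, Continuous (c n)) (n : ℕ)
    (t : ℝ) :
    HasDerivAt (iteratedPrimitive c (n + 1)) (c n t * iteratedPrimitive c n t) t := by
  have h : Continuous fun s => c n s * iteratedPrimitive c n s :=
    (hc n).mul (continuous_iteratedPrimitive hc n)
  exact intervalIntegral.integral_hasDerivAt_right (h.intervalIntegrable _ _)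
    (h.stronglyMeasurableAtFilter _ _) h.continuousAt

theorem abs_iteratedPrimitive_le {c : ℕ → ℝ → ℝ} (hc : ∀ n, Continuous (c n))
    (hc1 : ∀ n t, |c n t| ≤ 1) (n : ℕ) (t : ℝ) :
    |iteratedPrimitive c n t| ≤ |t| ^ n / n.factorial := by
  induction n generalizing t with
  | zero => simp [iteratedPrimitive]
  | succ n ih =>
    have h1 : |iteratedPrimitive c (n + 1) t| ≤
        ∫ s in uIoc 0 t, |c n s * iteratedPrimitive c n s| := by
      simpa [iteratedPrimitive] using
        intervalIntegral.norm_integral_le_integral_norm_uIoc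
          (f := fun s => c n s * iteratedPrimitive c n s) (a := 0) (b := t) (μ := volume)
    have hcont := ((hc n).mul (continuous_iteratedPrimitive hc n)).abs
    have h2 : ∫ s in uIoc 0 t, |c n s * iteratedPrimitive c n s| ≤
        ∫ s in uIoc 0 t, |s - 0| ^ n * ((n.factorial : ℝ)⁻¹) := by
      refine setIntegral_mono_on ?_ ?_ measurableSet_uIoc ?_
      · exact (hcont.intervalIntegrable (μ := volume) 0 t).def'
      · exact (Continuous.intervalIntegrable (μ := volume) (by fun_prop) 0 t).def'
      · intro s _
        rw [abs_mul, sub_zero, ← div_eq_mul_inv]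
        calc |c n s| * |iteratedPrimitive c n s| ≤ 1 * (|s| ^ n / n.factorial) := by
              gcongr
              · exact hc1 n s
              · exact ih s
          _ = _ := one_mul _
    refine (h1.trans h2).trans (le_of_eq ?_)
    rw [integral_mul_const, integral_pow_abs_sub_uIoc, sub_zero, Nat.factorial_succ]
    push_cast
    field_simp

/-- Weakening (2n)! to n! makes the terms of an exponential series in L R² a majorant that is
uniform on bounded sets of times and parameters. -/
theorem abs_pow_mul_iteratedPrimitive_even_le {c : ℕ → ℝ → ℝ} (hc : ∀ n, Continuous (c n))
    (hc1 : ∀ n t, |c n t| ≤ 1) {R L l t : ℝ} (ht : |t| ≤ R) (hl : |l| ≤ L) (n : ℕ) :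
    |(-l) ^ n * iteratedPrimitive c (2 * n) t| ≤ (L * R ^ 2) ^ n / n.factorial := by
  have hR : 0 ≤ R := (abs_nonneg t).trans ht
  have hL : 0 ≤ L := (abs_nonneg l).trans hl
  rw [abs_mul, abs_pow, abs_neg]
  calc |l| ^ n * |iteratedPrimitive c (2 * n) t|
      ≤ L ^ n * (R ^ (2 * n) / n.factorial) := by
        gcongr
        refine (abs_iteratedPrimitive_le hc hc1 _ t).trans ?_
        gcongr
        omega
    _ = _ := by rw [mul_pow, pow_mul]; ring

theorem abs_pow_mul_iteratedPrimitive_odd_le {c : ℕ → ℝ → ℝ} (hc : ∀ n, Continuous (c n))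
    (hc1 : ∀ n t, |c n t| ≤ 1) {R L l t : ℝ} (ht : |t| ≤ R) (hl : |l| ≤ L) (n : ℕ) :
    |(-l) ^ n * iteratedPrimitive c (2 * n + 1) t| ≤ R * ((L * R ^ 2) ^ n / n.factorial) := by
  have hR : 0 ≤ R := (abs_nonneg t).trans ht
  have hL : 0 ≤ L := (abs_nonneg l).trans hl
  rw [abs_mul, abs_pow, abs_neg]
  calc |l| ^ n * |iteratedPrimitive c (2 * n + 1) t|
      ≤ L ^ n * (R ^ (2 * n + 1) / n.factorial) := by
        gcongr
        refine (abs_iteratedPrimitive_le hc hc1 _ t).trans ?_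
        gcongr
        omega
    _ = _ := by rw [mul_pow, pow_succ, pow_mul]; ring

/-- Solutions of the linear system `σ' = -l b₁ ρ`, `ρ' = b₀ σ`, `σ(0) = 1`, `ρ(0) = 0`, depending
continuously on time and on the parameter `l`. -/
theorem exists_linear_system_solution {b₀ b₁ : ℝ → ℝ} (hb₀ : Continuous b₀) (hb₁ : Continuous b₁)
    (h₀ : ∀ t, |b₀ t| ≤ 1) (h₁ : ∀ t, |b₁ t| ≤ 1) :
    ∃ σ ρ : ℝ → ℝ → ℝ, Continuous (fun p : ℝ × ℝ => σ p.1 p.2) ∧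
      Continuous (fun p : ℝ × ℝ => ρ p.1 p.2) ∧
      (∀ l t, HasDerivAt (fun s => σ s l) (-l * (b₁ t * ρ t l)) t) ∧
      (∀ l t, HasDerivAt (fun s => ρ s l) (b₀ t * σ t l) t) ∧
      (∀ l, σ 0 l = 1) ∧ ∀ l, ρ 0 l = 0 := by
  -- Picard iteration applies `b₀` and `b₁` alternately, starting from the constant 1 with `b₀`;
  -- even iterates build `σ`, odd ones `ρ`.
  let c : ℕ → ℝ → ℝ := fun n => if Even n then b₀ else b₁
  have hc : ∀ n, Continuous (c n) := fun n => by dsimp only [c]; split_ifs <;> assumption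
  have hc1 : ∀ n t, |c n t| ≤ 1 := fun n t => by
    dsimp only [c]; split_ifs
    exacts [h₀ t, h₁ t]
  have hce : ∀ n, c (2 * n) = b₀ := fun n => by simp [c]
  have hco : ∀ n, c (2 * n + 1) = b₁ := fun n => by simp [c]
  let Y := iteratedPrimitive c
  have hY0 : ∀ n, Y (n + 1) 0 = 0 := fun n => by simp [Y, iteratedPrimitive]
  have hsum : ∀ x : ℝ, Summable fun n : ℕ => x ^ n / (n.factorial : ℝ) :=
    Real.summable_pow_div_factorial
  let σ : ℝ → ℝ → ℝ := fun t l => ∑' n : ℕ, (-l) ^ n * Y (2 * n) t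
  let ρ : ℝ → ℝ → ℝ := fun t l => ∑' n : ℕ, (-l) ^ n * Y (2 * n + 1) t
  have sumσ : ∀ l t, Summable fun n : ℕ => (-l) ^ n * Y (2 * n) t := fun l t =>
    Summable.of_norm_bounded (hsum _)
      fun n => abs_pow_mul_iteratedPrimitive_even_le hc hc1 le_rfl le_rfl n
  have sumρ : ∀ l t, Summable fun n : ℕ => (-l) ^ n * Y (2 * n + 1) t := fun l t =>
    Summable.of_norm_bounded ((hsum _).mul_left _)
      fun n => abs_pow_mul_iteratedPrimitive_odd_le hc hc1 le_rfl le_rfl n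
  have hnear : ∀ p : ℝ × ℝ, {q : ℝ × ℝ | |q.1| ≤ |p.1| + 1 ∧ |q.2| ≤ |p.2| + 1} ∈ 𝓝 p := by
    intro p
    have h1 : ∀ᶠ q : ℝ × ℝ in 𝓝 p, |q.1| < |p.1| + 1 :=
      (continuous_fst.abs.continuousAt (x := p)).eventually_lt continuousAt_const (by simp)
    have h2 : ∀ᶠ q : ℝ × ℝ in 𝓝 p, |q.2| < |p.2| + 1 :=
      (continuous_snd.abs.continuousAt (x := p)).eventually_lt continuousAt_const (by simp)
    filter_upwards [h1, h2] with q h1 h2 using ⟨h1.le, h2.le⟩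
  have hYc : ∀ n, Continuous (Y n) := continuous_iteratedPrimitive hc
  refine ⟨σ, ρ, ?_, ?_, ?_, ?_, ?_, ?_⟩
  · refine continuous_iff_continuousAt.2 fun p => ContinuousOn.continuousAt ?_ (hnear p)
    refine continuousOn_tsum (fun n => ?_) (hsum ((|p.2| + 1) * (|p.1| + 1) ^ 2))
      fun n q hq => abs_pow_mul_iteratedPrimitive_even_le hc hc1 hq.1 hq.2 n
    have := hYc (2 * n)
    fun_prop
  · refine continuous_iff_continuousAt.2 fun p => ContinuousOn.continuousAt ?_ (hnear p)
    refine continuousOn_tsum (fun n => ?_)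
      ((hsum ((|p.2| + 1) * (|p.1| + 1) ^ 2)).mul_left (|p.1| + 1))
      fun n q hq => abs_pow_mul_iteratedPrimitive_odd_le hc hc1 hq.1 hq.2 n
    have := hYc (2 * n + 1)
    fun_prop
  · intro l t
    -- The constant zeroth term is split off, so that each remaining even primitive differentiates
    -- to `b₁` times the preceding odd one.
    have key : HasDerivAt (fun s => ∑' n : ℕ, (-l) ^ (n + 1) * Y (2 * (n + 1)) s)
        (∑' n : ℕ, (-l) ^ (n + 1) * (b₁ t * Y (2 * n + 1) t)) t := by
      refine hasDerivAt_tsum_of_isPreconnected (t := Ioo (-(|t| + 1)) (|t| + 1)) (y₀ := t)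
        (g := fun n s => (-l) ^ (n + 1) * Y (2 * (n + 1)) s)
        (g' := fun n s => (-l) ^ (n + 1) * (b₁ s * Y (2 * n + 1) s))
        (((hsum (|l| * (|t| + 1) ^ 2)).mul_left (|t| + 1)).mul_left |l|) isOpen_Ioo
        isPreconnected_Ioo (fun n s _ => ?_) (fun n s hs => ?_) ?_ ?_ ?_
      · have := (hasDerivAt_iteratedPrimitive hc (2 * n + 1) s).const_mul ((-l) ^ (n + 1))
        rwa [hco] at this
      · have := abs_pow_mul_iteratedPrimitive_odd_le hc hc1 (abs_lt.2 hs).le (le_refl |l|) n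
        rw [Real.norm_eq_abs, show (-l) ^ (n + 1) * (b₁ s * Y (2 * n + 1) s) =
          -(l * (b₁ s * ((-l) ^ n * Y (2 * n + 1) s))) by ring, abs_neg, abs_mul]
        gcongr
        rw [abs_mul]
        exact (mul_le_of_le_one_left (abs_nonneg _) (h₁ s)).trans this
      · exact abs_lt.1 (by linarith)
      · exact (summable_nat_add_iff 1).2 (sumσ l t)
      · exact abs_lt.1 (by linarith)
    have e1 : (fun s => σ s l) =
        fun s => 1 + ∑' n : ℕ, (-l) ^ (n + 1) * Y (2 * (n + 1)) s := by
      funext s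
      simp only [σ]
      rw [(sumσ l s).tsum_eq_zero_add]
      simp [Y, iteratedPrimitive]
    rw [e1]
    refine (key.const_add 1).congr_deriv ?_
    change _ = -l * (b₁ t * ∑' n : ℕ, (-l) ^ n * Y (2 * n + 1) t)
    rw [← tsum_mul_left, ← tsum_mul_left]
    exact tsum_congr fun n => by ring
  · intro l t
    have key : HasDerivAt (fun s => ∑' n : ℕ, (-l) ^ n * Y (2 * n + 1) s)
        (∑' n : ℕ, (-l) ^ n * (b₀ t * Y (2 * n) t)) t := by
      refine hasDerivAt_tsum_of_isPreconnected (t := Ioo (-(|t| + 1)) (|t| + 1)) (y₀ := t)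
        (g := fun n s => (-l) ^ n * Y (2 * n + 1) s)
        (g' := fun n s => (-l) ^ n * (b₀ s * Y (2 * n) s))
        (hsum (|l| * (|t| + 1) ^ 2)) isOpen_Ioo
        isPreconnected_Ioo (fun n s _ => ?_) (fun n s hs => ?_) ?_ (sumρ l t) ?_
      · have := (hasDerivAt_iteratedPrimitive hc (2 * n) s).const_mul ((-l) ^ n)
        rwa [hce] at this
      · have := abs_pow_mul_iteratedPrimitive_even_le hc hc1 (abs_lt.2 hs).le (le_refl |l|) n
        rw [Real.norm_eq_abs, mul_left_comm, abs_mul]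
        exact (mul_le_of_le_one_left (abs_nonneg _) (h₀ s)).trans this
      · exact abs_lt.1 (by linarith)
      · exact abs_lt.1 (by linarith)
    refine key.congr_deriv ?_
    change _ = b₀ t * ∑' n : ℕ, (-l) ^ n * Y (2 * n) t
    rw [← tsum_mul_left]
    exact tsum_congr fun n => by ring
  · intro l
    simp only [σ]
    rw [tsum_eq_single 0]
    · simp [Y, iteratedPrimitive]
    · intro n hn
      obtain ⟨m, rfl⟩ := Nat.exists_eq_succ_of_ne_zero hn
      simp [mul_add, show 2 * m + 2 = (2 * m + 1) + 1 from rfl, hY0]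
  · intro l
    simp [ρ, hY0]

/-! ### Energy estimate at a fixed frequency -/

/-- Weakly hyperbolic energy estimate for `y'' + k a y = 0` with a nondecreasing coefficient
`0 ≤ a ≤ 1`; the constant loses one power of `k` and does not depend on `a`. -/
theorem oscillator_energy_le {E : Type*} [NormedAddCommGroup E] [InnerProductSpace ℝ E]
    {a a' : ℝ → ℝ} (ha : ∀ t, HasDerivAt a (a' t) t) (ha' : ∀ t, 0 ≤ a' t)
    (ha0 : ∀ t, 0 ≤ a t) (ha1 : ∀ t, a t ≤ 1) {k : ℝ} (hk : 0 ≤ k) {y z : ℝ → E}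
    (hy : ∀ t, HasDerivAt y (z t) t) (hz : ∀ t, HasDerivAt z (-(k * a t) • y t) t) (t : ℝ) :
    ‖y t‖ ^ 2 + ‖z t‖ ^ 2 ≤ Real.exp |t| * (1 + k) * (‖y 0‖ ^ 2 + ‖z 0‖ ^ 2) := by
  -- The added 1 keeps control of `y` where `a` vanishes and makes the later division by `k * a t +
  -- 1` legitimate.
  let F : ℝ → ℝ := fun t => ‖z t‖ ^ 2 + (k * a t + 1) * ‖y t‖ ^ 2
  let F' : ℝ → ℝ := fun t => 2 * inner ℝ (y t) (z t) + k * a' t * ‖y t‖ ^ 2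
  have hF : ∀ t, HasDerivAt F (F' t) t := by
    intro t
    have h := (hz t).norm_sq.add ((((ha t).const_mul k).add_const 1).mul (hy t).norm_sq)
    refine h.congr_deriv ?_
    rw [inner_smul_right, real_inner_comm (y t) (z t)]
    simp only [F']
    ring
  have hpos : ∀ t, 0 < k * a t + 1 := fun t => by have := mul_nonneg hk (ha0 t); linarith
  have hk1 : ∀ t, 0 ≤ k * a' t := fun t => mul_nonneg hk (ha' t)
  have hin : ∀ t, |2 * inner ℝ (y t) (z t)| ≤ ‖z t‖ ^ 2 + ‖y t‖ ^ 2 := fun t => by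
    rw [abs_mul, abs_two]
    nlinarith [abs_real_inner_le_norm (y t) (z t), sq_nonneg (‖y t‖ - ‖z t‖)]
  have hle : ∀ t, ‖y t‖ ^ 2 + ‖z t‖ ^ 2 ≤ F t := fun t => by
    simp only [F]
    nlinarith [mul_nonneg (mul_nonneg hk (ha0 t)) (sq_nonneg ‖y t‖)]
  have hF0 : F 0 ≤ (k * a 0 + 1) * (‖y 0‖ ^ 2 + ‖z 0‖ ^ 2) := by
    simp only [F]
    nlinarith [mul_nonneg (mul_nonneg hk (ha0 0)) (sq_nonneg ‖z 0‖)]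
  have hk2 : ∀ t, k * a t + 1 ≤ 1 + k := fun t => by nlinarith [ha1 t]
  have hS : 0 ≤ ‖y 0‖ ^ 2 + ‖z 0‖ ^ 2 := by positivity
  rcases le_total 0 t with ht | ht
  · have hanti : Antitone fun t => Real.exp (-t) * F t / (k * a t + 1) := by
      refine antitone_of_hasDerivAt_nonpos
        (fun t => (((hasDerivAt_neg t).exp).mul (hF t)).div
          (((ha t).const_mul k).add_const 1) (hpos t).ne') fun t => ?_
      refine div_nonpos_of_nonpos_of_nonneg ?_ (sq_nonneg _)
      have e : (Real.exp (-t) * -1 * F t + Real.exp (-t) * F' t) * (k * a t + 1) -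
          Real.exp (-t) * F t * (k * a' t) =
          Real.exp (-t) * ((F' t - F t) * (k * a t + 1) - F t * (k * a' t)) := by ring
      rw [Pi.mul_apply, e]
      refine mul_nonpos_of_nonneg_of_nonpos (Real.exp_pos _).le ?_
      have h1 := (abs_le.1 (hin t)).2
      have h2 := hle t
      -- The `‖y t‖ ^ 2 * a' t` contributions cancel exactly; the one surviving term with `a' t` has
      -- a favourable sign.
      have : (F' t - F t) * (k * a t + 1) - F t * (k * a' t) =
        (2 * inner ℝ (y t) (z t) - F t) * (k * a t + 1) - ‖z t‖ ^ 2 * (k * a' t) := by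
        simp only [F, F']; ring
      rw [this]
      have h3 : (2 * inner ℝ (y t) (z t) - F t) * (k * a t + 1) ≤ 0 :=
        mul_nonpos_of_nonpos_of_nonneg (by linarith) (hpos t).le
      have h4 := mul_nonneg (sq_nonneg ‖z t‖) (hk1 t)
      linarith
    have h := hanti ht
    simp only [neg_zero, Real.exp_zero, one_mul] at h
    rw [div_le_div_iff₀ (hpos t) (hpos 0)] at h
    have h5 : Real.exp (-t) * F t * (k * a 0 + 1) ≤
        (1 + k) * (‖y 0‖ ^ 2 + ‖z 0‖ ^ 2) * (k * a 0 + 1) := by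
      calc _ ≤ F 0 * (k * a t + 1) := h
        _ ≤ ((k * a 0 + 1) * (‖y 0‖ ^ 2 + ‖z 0‖ ^ 2)) * (1 + k) := by
          exact mul_le_mul hF0 (hk2 t) (hpos t).le (mul_nonneg (hpos 0).le hS)
        _ = _ := by ring
    have h6 := le_of_mul_le_mul_right h5 (hpos 0)
    calc _ ≤ F t := hle t
      _ = Real.exp |t| * (Real.exp (-t) * F t) := by
        rw [abs_of_nonneg ht, ← mul_assoc, ← Real.exp_add]; simp
      _ ≤ _ := by rw [mul_assoc]; gcongr
  -- In negative time the term with `a'` already has the right sign, so no division is needed.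
  · have hmono : Monotone fun t => Real.exp t * F t := by
      refine monotone_of_hasDerivAt_nonneg (fun t => (Real.hasDerivAt_exp t).mul (hF t))
        fun t => ?_
      have h1 := (abs_le.1 (hin t)).1
      have h2 := hle t
      have h3 := mul_nonneg (hk1 t) (sq_nonneg ‖y t‖)
      have : 0 ≤ F t + F' t := by simp only [F']; linarith
      have := mul_nonneg (Real.exp_pos t).le this
      simpa [mul_add] using this
    have h := hmono ht
    simp only [Real.exp_zero, one_mul] at h
    calc _ ≤ F t := hle t
      _ = Real.exp |t| * (Real.exp t * F t) := by
        rw [abs_of_nonpos ht, ← mul_assoc, ← Real.exp_add]; simp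
      _ ≤ Real.exp |t| * ((1 + k) * (‖y 0‖ ^ 2 + ‖z 0‖ ^ 2)) := by
        refine mul_le_mul_of_nonneg_left (h.trans (hF0.trans ?_)) (Real.exp_pos _).le
        exact mul_le_mul_of_nonneg_right (hk2 0) hS
      _ = _ := by ring

/-! ### Plancherel's identity and decay of the Fourier transform -/

theorem continuous_fourier_of_integrable {f : ℝ → ℂ} (hf : Integrable f) : Continuous (𝓕 f) :=
  VectorFourier.fourierIntegral_continuous Real.continuous_fourierChar continuous_inner hf

/-- The Fourier transform on `L²` is given by the Fourier integral on `L¹ ∩ L²`. -/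
theorem coeFn_fourier_toLp_two {f : ℝ → ℂ} (h1 : Integrable f) (h2 : MemLp f 2) :
    (𝓕 h2.toLp : Lp ℂ 2 (volume : Measure ℝ)) =ᵐ[volume] 𝓕 f := by
  refine ae_eq_of_integral_contDiff_smul_eq
    ((Lp.memLp _).locallyIntegrable (by norm_num))
    (continuous_fourier_of_integrable h1).locallyIntegrable fun g hg hgc => ?_
  let G : 𝓢(ℝ, ℂ) := HasCompactSupport.toSchwartzMap (f := fun x => (g x : ℂ))
    (hgc.comp_left (g := fun r : ℝ => (r : ℂ)) (by simp)) (Complex.ofRealCLM.contDiff.comp hg)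
  have hG : ∀ x, G x = (g x : ℂ) := fun _ => rfl
  -- Both sides are tested against a Schwartz function: the L² transform agrees with the
  -- distributional one, and Fubini moves the Fourier integral from the test function to `f`.
  have key := congrArg (fun S : 𝓢'(ℝ, ℂ) => S G)
    (Lp.fourier_toTemperedDistribution_eq (E := ℝ) (F := ℂ) h2.toLp)
  simp only [TemperedDistribution.fourier_apply, Lp.toTemperedDistribution_apply] at key
  have e1 : ∫ x, g x • (𝓕 h2.toLp : Lp ℂ 2 (volume : Measure ℝ)) x =
      ∫ x, G x • (𝓕 h2.toLp : Lp ℂ 2 (volume : Measure ℝ)) x :=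
    integral_congr_ae (Eventually.of_forall fun x => by simp [hG])
  have e2 : ∫ x, (𝓕 G) x • (h2.toLp f : ℝ → ℂ) x = ∫ x, (𝓕 G) x • f x := by
    refine integral_congr_ae ?_
    filter_upwards [h2.coeFn_toLp] with x hx
    rw [hx]
  have e3 : ∫ x, (𝓕 G) x • f x = ∫ x, G x • 𝓕 f x := by
    simpa [SchwartzMap.fourier_coe] using!
      VectorFourier.integral_fourierIntegral_smul_eq_flip (L := innerₗ ℝ) (μ := volume)
        (ν := volume) Real.continuous_fourierChar continuous_inner G.integrable h1
  rw [e1, ← key, e2, e3]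
  exact integral_congr_ae (Eventually.of_forall fun x => by simp [hG])

/-- Plancherel's identity on `L¹ ∩ L²`. -/
theorem lintegral_enorm_sq_fourier {f : ℝ → ℂ} (h1 : Integrable f) (h2 : MemLp f 2) :
    ∫⁻ x, ‖𝓕 f x‖ₑ ^ 2 = ∫⁻ x, ‖f x‖ₑ ^ 2 := by
  have hsq : ∀ h : ℝ → ℂ, ∫⁻ x, ‖h x‖ₑ ^ 2 = eLpNorm h 2 volume ^ 2 := by
    intro h
    have := eLpNorm_nnreal_pow_eq_lintegral (f := h) (μ := volume) (p := 2) (by norm_num)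
    simpa using this.symm
  rw [hsq, hsq, ← eLpNorm_congr_ae (coeFn_fourier_toLp_two h1 h2),
    ← eLpNorm_congr_ae h2.coeFn_toLp, ← Lp.enorm_def, ← Lp.enorm_def]
  rw [← ofReal_norm, ← ofReal_norm, Lp.norm_fourier_eq]

theorem lintegral_enorm_sq_fourierInv {f : ℝ → ℂ} (h1 : Integrable f) (h2 : MemLp f 2) :
    ∫⁻ x, ‖𝓕⁻ f x‖ₑ ^ 2 = ∫⁻ x, ‖f x‖ₑ ^ 2 := by
  simp_rw [Real.fourierInv_eq_fourier_neg]
  rw [lintegral_neg_eq_self (μ := (volume : Measure ℝ)) (fun x => ‖𝓕 f x‖ₑ ^ 2),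
    lintegral_enorm_sq_fourier h1 h2]

theorem lintegral_enorm_sq_iteratedDeriv {g : ℝ → ℂ} (hg : ContDiff ℝ ∞ g)
    (hgc : HasCompactSupport g) (j : ℕ) :
    ∫⁻ x, ‖iteratedDeriv j g x‖ₑ ^ 2 =
      ∫⁻ x : ℝ, ENNReal.ofReal ((2 * Real.pi * x) ^ (2 * j)) * ‖𝓕 g x‖ₑ ^ 2 := by
  have hcont : ∀ n : ℕ, Continuous (iteratedDeriv n g) := fun n =>
    hg.continuous_iteratedDeriv n (by exact_mod_cast le_top)
  have hsupp : ∀ n : ℕ, HasCompactSupport (iteratedDeriv n g) := fun n => by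
    induction n with
    | zero => simpa using hgc
    | succ n ih => rw [iteratedDeriv_succ]; exact ih.deriv
  have hint : ∀ n : ℕ, Integrable (iteratedDeriv n g) := fun n =>
    (hcont n).integrable_of_hasCompactSupport (hsupp n)
  rw [← lintegral_enorm_sq_fourier (hint j) ((hcont j).memLp_of_hasCompactSupport (hsupp j)),
    Real.fourier_iteratedDeriv (N := ⊤) hg (fun n _ => hint n) (by exact_mod_cast le_top)]
  refine lintegral_congr fun x => ?_
  beta_reduce
  rw [smul_eq_mul, enorm_mul, mul_pow]
  congr 1
  rw [← ofReal_norm, ← ENNReal.ofReal_pow (norm_nonneg _)]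
  congr 1
  rw [norm_pow, ← pow_mul, mul_comm j 2]
  simp only [norm_mul, Complex.norm_real, Complex.norm_I, mul_one, Complex.norm_ofNat]
  rw [pow_mul, pow_mul]
  congr 1
  simp [mul_pow]

theorem exists_pow_mul_norm_fourier_le {g : ℝ → ℂ} (hg : ContDiff ℝ ∞ g)
    (hgc : HasCompactSupport g) (n : ℕ) : ∃ C, ∀ x : ℝ, |x| ^ n * ‖𝓕 g x‖ ≤ C := by
  obtain ⟨C, hC⟩ := (𝓕 (hgc.toSchwartzMap hg)).decay n 0
  refine ⟨C, fun x => ?_⟩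
  have := hC.2 x
  rw [norm_iteratedFDeriv_zero] at this
  exact this

/-! ### Joint regularity of functions synthesised from Fourier densities -/

/-- Continuous partial derivatives assemble into a total derivative, which is then as smooth as they
are. This lets joint regularity be raised one order at a time. -/
theorem contDiff_succ_of_partial {n : ℕ} {f f₁ f₂ : ℝ → ℝ → ℂ}
    (d₁ : ∀ t x, HasDerivAt (fun s => f s x) (f₁ t x) t)
    (d₂ : ∀ t x, HasDerivAt (f t) (f₂ t x) x)
    (h₁ : ContDiff ℝ n fun p : ℝ × ℝ => f₁ p.1 p.2)
    (h₂ : ContDiff ℝ n fun p : ℝ × ℝ => f₂ p.1 p.2) :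
    ContDiff ℝ (n + 1) fun p : ℝ × ℝ => f p.1 p.2 := by
  refine (contDiff_succ_iff_hasFDerivAt (n := n)).2
    ⟨fun p => (ContinuousLinearMap.toSpanSingleton ℝ (f₁ p.1 p.2)).coprod
      (ContinuousLinearMap.toSpanSingleton ℝ (f₂ p.1 p.2)), ?_, fun p => ?_⟩
  · have e : (fun p : ℝ × ℝ => (ContinuousLinearMap.toSpanSingleton ℝ (f₁ p.1 p.2)).coprod
        (ContinuousLinearMap.toSpanSingleton ℝ (f₂ p.1 p.2))) =
        fun p => (ContinuousLinearMap.fst ℝ ℝ ℝ).smulRight (f₁ p.1 p.2) +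
          (ContinuousLinearMap.snd ℝ ℝ ℝ).smulRight (f₂ p.1 p.2) := by
      funext p
      ext <;> simp
    rw [e]
    exact (contDiff_const.smulRight h₁).add (contDiff_const.smulRight h₂)
  · have c₁ : Continuous fun p : ℝ × ℝ =>
        ContinuousLinearMap.toSpanSingleton ℝ (f₁ p.1 p.2) := by
      have := h₁.continuous
      exact (ContinuousLinearMap.toSpanSingletonCLE (𝕜 := ℝ) (E := ℂ)).continuous.comp this
    have c₂ : Continuous fun p : ℝ × ℝ =>
        ContinuousLinearMap.toSpanSingleton ℝ (f₂ p.1 p.2) := by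
      have := h₂.continuous
      exact (ContinuousLinearMap.toSpanSingletonCLE (𝕜 := ℝ) (E := ℂ)).continuous.comp this
    exact (hasStrictFDerivAt_uncurry_coprod (𝕜 := ℝ) (u := p) (f := f)
      (f₁ := fun t x => ContinuousLinearMap.toSpanSingleton ℝ (f₁ t x))
      (f₂ := fun t x => ContinuousLinearMap.toSpanSingleton ℝ (f₂ t x))
      (Eventually.of_forall fun v => (d₁ v.1 v.2).hasFDerivAt)
      (Eventually.of_forall fun v => (d₂ v.1 v.2).hasFDerivAt)
      c₁.continuousAt c₂.continuousAt).hasFDerivAt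

/-- Time dependent Fourier densities: jointly continuous in time and frequency, and rapidly
decreasing in frequency, locally uniformly in time. -/
structure IsRapidDensity (m : ℝ → ℝ → ℂ) : Prop where
  continuous : Continuous fun p : ℝ × ℝ => m p.1 p.2
  decay : ∀ (R : ℝ) (n : ℕ), ∃ C, ∀ t ξ, |t| ≤ R → |ξ| ^ n * ‖m t ξ‖ ≤ C

/-- The function `x ↦ ∫ exp(2πixξ) m(t, ξ) dξ` with prescribed Fourier density. -/
noncomputable def fourierSynthesis (m : ℝ → ℝ → ℂ) (t x : ℝ) : ℂ := 𝓕⁻ (m t) x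

theorem fourierSynthesis_eq (m : ℝ → ℝ → ℂ) (t x : ℝ) :
    fourierSynthesis m t x = ∫ ξ : ℝ, Complex.exp (2 * Real.pi * ξ * x * Complex.I) * m t ξ := by
  rw [fourierSynthesis, Real.fourierInv_eq']
  refine integral_congr_ae (Eventually.of_forall fun ξ => ?_)
  simp only [RCLike.inner_apply, conj_trivial, smul_eq_mul]
  congr 2
  push_cast
  ring

theorem norm_exp_two_pi_mul (ξ x : ℝ) :
    ‖Complex.exp (2 * Real.pi * ξ * x * Complex.I)‖ = 1 := by
  rw [show (2 * Real.pi * ξ * x * Complex.I : ℂ) = ((2 * Real.pi * ξ * x : ℝ) : ℂ) * Complex.I by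
    push_cast; ring]
  exact Complex.norm_exp_ofReal_mul_I _

namespace IsRapidDensity

variable {m : ℝ → ℝ → ℂ}

theorem continuous_apply (hm : IsRapidDensity m) (t : ℝ) : Continuous (m t) :=
  hm.continuous.comp (by fun_prop : Continuous fun ξ : ℝ => (t, ξ))

/-- Supplies one integrable majorant for a whole time interval, as dominated convergence requires.
-/
theorem exists_bound (hm : IsRapidDensity m) (R : ℝ) :
    ∃ C, ∀ t ξ, |t| ≤ R → ‖m t ξ‖ ≤ C * (1 + ξ ^ 2)⁻¹ := by
  obtain ⟨C₀, h₀⟩ := hm.decay R 0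
  obtain ⟨C₂, h₂⟩ := hm.decay R 2
  refine ⟨C₀ + C₂, fun t ξ ht => ?_⟩
  rw [← div_eq_mul_inv, le_div_iff₀ (by positivity)]
  have h0 := h₀ t ξ ht
  have h2 := h₂ t ξ ht
  rw [sq_abs] at h2
  rw [pow_zero, one_mul] at h0
  linarith

theorem integrable (hm : IsRapidDensity m) (t : ℝ) : Integrable (m t) := by
  obtain ⟨C, hC⟩ := hm.exists_bound |t|
  exact (integrable_inv_one_add_sq.const_mul C).mono' (hm.continuous_apply t).aestronglyMeasurable
    (Eventually.of_forall fun ξ => hC t ξ le_rfl)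

theorem memLp_two (hm : IsRapidDensity m) (t : ℝ) : MemLp (m t) 2 := by
  obtain ⟨C, hC⟩ := hm.decay |t| 0
  have hmc := hm.continuous_apply t
  refine (memLp_two_iff_integrable_sq_norm hmc.aestronglyMeasurable).2
    (((hm.integrable t).norm.const_mul C).mono'
      (Continuous.aestronglyMeasurable (by fun_prop)) (Eventually.of_forall fun ξ => ?_))
  have := hC t ξ le_rfl
  rw [pow_zero, one_mul] at this
  rw [Real.norm_of_nonneg (by positivity), sq]
  gcongr

theorem mul_left (hm : IsRapidDensity m) {b : ℝ → ℂ} (hb : Continuous b) :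
    IsRapidDensity fun t ξ => b t * m t ξ := by
  refine ⟨(hb.comp continuous_fst).mul hm.continuous, fun R n => ?_⟩
  obtain ⟨C, hC⟩ := hm.decay R n
  obtain ⟨B, hB⟩ := isCompact_Icc.exists_bound_of_continuousOn (s := Icc (-R) R) hb.continuousOn
  refine ⟨B * C, fun t ξ ht => ?_⟩
  rw [norm_mul, mul_left_comm]
  have := hB t (abs_le.1 ht)
  exact mul_le_mul this (hC t ξ ht) (by positivity) ((norm_nonneg _).trans this)

theorem mul_frequency (hm : IsRapidDensity m) :
    IsRapidDensity fun t ξ => (2 * Real.pi * Complex.I * ξ) * m t ξ := by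
  refine ⟨Continuous.mul (by fun_prop) hm.continuous, fun R n => ?_⟩
  obtain ⟨C, hC⟩ := hm.decay R (n + 1)
  refine ⟨2 * Real.pi * C, fun t ξ ht => ?_⟩
  have e : |ξ| ^ n * ‖(2 * Real.pi * Complex.I * ξ) * m t ξ‖ =
      2 * Real.pi * (|ξ| ^ (n + 1) * ‖m t ξ‖) := by
    simp only [norm_mul, Complex.norm_real, Complex.norm_I, Complex.norm_ofNat, Real.norm_eq_abs,
      abs_of_pos Real.pi_pos]
    ring
  rw [e]
  exact mul_le_mul_of_nonneg_left (hC t ξ ht) (by positivity)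

theorem continuous_fourierSynthesis (hm : IsRapidDensity m) :
    Continuous fun p : ℝ × ℝ => fourierSynthesis m p.1 p.2 := by
  simp_rw [fourierSynthesis_eq]
  refine continuous_iff_continuousAt.2 fun p => ?_
  obtain ⟨C, hC⟩ := hm.exists_bound (|p.1| + 1)
  have hnear : ∀ᶠ q : ℝ × ℝ in 𝓝 p, |q.1| < |p.1| + 1 :=
    (continuous_fst.abs.continuousAt (x := p)).eventually_lt continuousAt_const (by simp)
  refine continuousAt_of_dominated (bound := fun ξ => C * (1 + ξ ^ 2)⁻¹)
    (Eventually.of_forall fun q => ?_) ?_ (integrable_inv_one_add_sq.const_mul C)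
    (Eventually.of_forall fun ξ => ?_)
  · have := hm.continuous_apply q.1
    exact Continuous.aestronglyMeasurable (by fun_prop)
  · filter_upwards [hnear] with q hq
    refine Eventually.of_forall fun ξ => ?_
    rw [norm_mul, norm_exp_two_pi_mul, one_mul]
    exact hC _ _ hq.le
  · have : Continuous fun q : ℝ × ℝ => m q.1 ξ :=
      hm.continuous.comp (by fun_prop : Continuous fun q : ℝ × ℝ => (q.1, ξ))
    exact (Continuous.mul (by fun_prop) this).continuousAt

theorem hasDerivAt_space (hm : IsRapidDensity m) (t x : ℝ) :
    HasDerivAt (fourierSynthesis m t)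
      (fourierSynthesis (fun t ξ => (2 * Real.pi * Complex.I * ξ) * m t ξ) t x) x := by
  have hfun : fourierSynthesis m t =
      fun x : ℝ => ∫ ξ : ℝ, Complex.exp (2 * Real.pi * ξ * x * Complex.I) * m t ξ :=
    funext fun x => fourierSynthesis_eq m t x
  rw [hfun, fourierSynthesis_eq]
  have hmc := hm.continuous_apply t
  refine (hasDerivAt_integral_of_dominated_loc_of_deriv_le (s := univ)
    (F := fun x ξ : ℝ => Complex.exp (2 * Real.pi * ξ * x * Complex.I) * m t ξ)
    (F' := fun x ξ : ℝ => Complex.exp (2 * Real.pi * ξ * x * Complex.I) *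
      ((2 * Real.pi * Complex.I * ξ) * m t ξ))
    (bound := fun ξ : ℝ => ‖(2 * Real.pi * Complex.I * ξ) * m t ξ‖) univ_mem
    (Eventually.of_forall fun y => Continuous.aestronglyMeasurable (by fun_prop)) ?_
    (Continuous.aestronglyMeasurable (by fun_prop)) (Eventually.of_forall fun ξ y _ => ?_)
    (hm.mul_frequency.integrable t).norm (Eventually.of_forall fun ξ y _ => ?_)).2
  · refine (hm.integrable t).norm.mono' (Continuous.aestronglyMeasurable (by fun_prop))
      (Eventually.of_forall fun ξ => ?_)
    rw [norm_mul, norm_exp_two_pi_mul, one_mul]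
  · rw [norm_mul, norm_exp_two_pi_mul, one_mul]
  · have h := ((((hasDerivAt_id y).ofReal_comp).const_mul (2 * Real.pi * ξ : ℂ)).mul_const
      Complex.I).cexp.mul_const (m t ξ)
    refine h.congr_deriv ?_
    simp only [id_eq, Complex.ofReal_one]
    ring

theorem hasDerivAt_time (hm : IsRapidDensity m) {m₁ : ℝ → ℝ → ℂ} (hm₁ : IsRapidDensity m₁)
    (hd : ∀ t ξ, HasDerivAt (fun s => m s ξ) (m₁ t ξ) t) (t x : ℝ) :
    HasDerivAt (fun s => fourierSynthesis m s x) (fourierSynthesis m₁ t x) t := by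
  simp_rw [fourierSynthesis_eq]
  obtain ⟨C, hC⟩ := hm₁.exists_bound (|t| + 1)
  refine (hasDerivAt_integral_of_dominated_loc_of_deriv_le (s := Metric.ball t 1)
    (F := fun s ξ : ℝ => Complex.exp (2 * Real.pi * ξ * x * Complex.I) * m s ξ)
    (F' := fun s ξ : ℝ => Complex.exp (2 * Real.pi * ξ * x * Complex.I) * m₁ s ξ)
    (bound := fun ξ : ℝ => C * (1 + ξ ^ 2)⁻¹) (Metric.ball_mem_nhds t one_pos)
    (Eventually.of_forall fun s => ?_) ?_ ?_ (Eventually.of_forall fun ξ s hs => ?_)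
    (integrable_inv_one_add_sq.const_mul C) (Eventually.of_forall fun ξ s _ => ?_)).2
  · have := hm.continuous_apply s
    exact Continuous.aestronglyMeasurable (by fun_prop)
  · have := hm.continuous_apply t
    refine (hm.integrable t).norm.mono' (Continuous.aestronglyMeasurable (by fun_prop))
      (Eventually.of_forall fun ξ => ?_)
    rw [norm_mul, norm_exp_two_pi_mul, one_mul]
  · have := hm₁.continuous_apply t
    exact Continuous.aestronglyMeasurable (by fun_prop)
  · rw [norm_mul, norm_exp_two_pi_mul, one_mul]
    refine hC s ξ ?_
    rw [Metric.mem_ball, Real.dist_eq] at hs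
    have := abs_sub_abs_le_abs_sub s t
    linarith
  · exact (hd s ξ).const_mul _

theorem contDiff_succ (hm : IsRapidDensity m) {m₁ : ℝ → ℝ → ℂ} (hm₁ : IsRapidDensity m₁)
    (hd : ∀ t ξ, HasDerivAt (fun s => m s ξ) (m₁ t ξ) t) {n : ℕ}
    (h₁ : ContDiff ℝ n fun p : ℝ × ℝ => fourierSynthesis m₁ p.1 p.2)
    (h₂ : ContDiff ℝ n fun p : ℝ × ℝ =>
      fourierSynthesis (fun t ξ => (2 * Real.pi * Complex.I * ξ) * m t ξ) p.1 p.2) :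
    ContDiff ℝ (n + 1) fun p : ℝ × ℝ => fourierSynthesis m p.1 p.2 :=
  contDiff_succ_of_partial (hm.hasDerivAt_time hm₁ hd) hm.hasDerivAt_space h₁ h₂

/-- The synthesis of a density with two time derivatives is of class `C²`. -/
theorem contDiff_two {m₁ m₂ : ℝ → ℝ → ℂ} (hm : IsRapidDensity m) (hm₁ : IsRapidDensity m₁)
    (hm₂ : IsRapidDensity m₂) (hd : ∀ t ξ, HasDerivAt (fun s => m s ξ) (m₁ t ξ) t)
    (hd₁ : ∀ t ξ, HasDerivAt (fun s => m₁ s ξ) (m₂ t ξ) t) :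
    ContDiff ℝ 2 fun p : ℝ × ℝ => fourierSynthesis m p.1 p.2 := by
  have c : ∀ {μ : ℝ → ℝ → ℂ}, IsRapidDensity μ →
      ContDiff ℝ (0 : ℕ) fun p : ℝ × ℝ => fourierSynthesis μ p.1 p.2 := fun hμ =>
    contDiff_zero.2 hμ.continuous_fourierSynthesis
  have h1 : ContDiff ℝ ((0 : ℕ) + 1) fun p : ℝ × ℝ => fourierSynthesis m₁ p.1 p.2 :=
    hm₁.contDiff_succ hm₂ hd₁ (c hm₂) (c hm₁.mul_frequency)
  have h2 : ContDiff ℝ ((0 : ℕ) + 1) fun p : ℝ × ℝ =>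
      fourierSynthesis (fun t ξ => (2 * Real.pi * Complex.I * ξ) * m t ξ) p.1 p.2 :=
    hm.mul_frequency.contDiff_succ hm₁.mul_frequency (fun t ξ => (hd t ξ).const_mul _)
      (c hm₁.mul_frequency) (c hm.mul_frequency.mul_frequency)
  have := hm.contDiff_succ hm₁ hd (n := 1) (by simpa using h1) (by simpa using h2)
  exact this.of_le (by norm_num)

end IsRapidDensity

/-! ### Existence and the Sobolev bound -/

/-- Fourier densities of the solution of `u_tt = a(t) u_xx` with given initial densities. -/
theorem exists_wave_density {a a' : ℝ → ℝ} (ha : ∀ t, HasDerivAt a (a' t) t)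
    (ha' : ∀ t, 0 ≤ a' t) (ha0 : ∀ t, 0 ≤ a t) (ha1 : ∀ t, a t ≤ 1) {h₀ h₁ : ℝ → ℂ}
    (hc₀ : Continuous h₀) (hc₁ : Continuous h₁)
    (hd₀ : ∀ n : ℕ, ∃ C, ∀ ξ : ℝ, |ξ| ^ n * ‖h₀ ξ‖ ≤ C)
    (hd₁ : ∀ n : ℕ, ∃ C, ∀ ξ : ℝ, |ξ| ^ n * ‖h₁ ξ‖ ≤ C) :
    ∃ m m₁ : ℝ → ℝ → ℂ, IsRapidDensity m ∧ IsRapidDensity m₁ ∧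
      (∀ t ξ, HasDerivAt (fun s => m s ξ) (m₁ t ξ) t) ∧
      (∀ t ξ : ℝ, HasDerivAt (fun s => m₁ s ξ) ((a t : ℂ) * ((2 * Real.pi * Complex.I * ξ) *
        ((2 * Real.pi * Complex.I * ξ) * m t ξ))) t) ∧
      m 0 = h₀ ∧ m₁ 0 = h₁ ∧
      ∀ t ξ, ‖m t ξ‖ ^ 2 ≤
        Real.exp |t| * (1 + (2 * Real.pi * ξ) ^ 2) * (‖h₀ ξ‖ ^ 2 + ‖h₁ ξ‖ ^ 2) := by
  have hac : Continuous a := continuous_iff_continuousAt.2 fun t => (ha t).continuousAt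
  have habs : ∀ t, |a t| ≤ 1 := fun t => abs_le.2 ⟨by linarith [ha0 t], ha1 t⟩
  -- Two uses of the system with the coefficients swapped: `σ₁` and `ρ₂` both solve y'' = -l a y,
  -- with data (1, 0) and (0, 1) respectively, like a cosine and a sine.
  obtain ⟨σ₁, ρ₁, cσ₁, cρ₁, dσ₁, dρ₁, iσ₁, iρ₁⟩ :=
    exists_linear_system_solution hac (continuous_const (y := (1 : ℝ))) habs (by simp)
  obtain ⟨σ₂, ρ₂, cσ₂, cρ₂, dσ₂, dρ₂, iσ₂, iρ₂⟩ :=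
    exists_linear_system_solution (continuous_const (y := (1 : ℝ))) hac (by simp) habs
  let k : ℝ → ℝ := fun ξ => (2 * Real.pi * ξ) ^ 2
  have hk : ∀ ξ, 0 ≤ k ξ := fun ξ => sq_nonneg _
  let m : ℝ → ℝ → ℂ := fun t ξ => σ₁ t (k ξ) • h₀ ξ + ρ₂ t (k ξ) • h₁ ξ
  let m₁ : ℝ → ℝ → ℂ := fun t ξ => (-k ξ * (1 * ρ₁ t (k ξ))) • h₀ ξ + (1 * σ₂ t (k ξ)) • h₁ ξ
  have hdm : ∀ t ξ, HasDerivAt (fun s => m s ξ) (m₁ t ξ) t := fun t ξ =>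
    ((dσ₁ (k ξ) t).smul_const _).add ((dρ₂ (k ξ) t).smul_const _)
  have hdm₁ : ∀ t ξ, HasDerivAt (fun s => m₁ s ξ) (-(k ξ * a t) • m t ξ) t := by
    intro t ξ
    have := ((((dρ₁ (k ξ) t).const_mul 1).const_mul (-k ξ)).smul_const (h₀ ξ)).add
      (((dσ₂ (k ξ) t).const_mul 1).smul_const (h₁ ξ))
    refine this.congr_deriv ?_
    simp only [m, smul_add, smul_smul]
    congr 2 <;> ring
  have im : m 0 = h₀ := by funext ξ; simp [m, iσ₁, iρ₂]
  have im₁ : m₁ 0 = h₁ := by funext ξ; simp [m₁, iρ₁, iσ₂]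
  have hen : ∀ t ξ, ‖m t ξ‖ ^ 2 + ‖m₁ t ξ‖ ^ 2 ≤
      Real.exp |t| * (1 + k ξ) * (‖h₀ ξ‖ ^ 2 + ‖h₁ ξ‖ ^ 2) := by
    intro t ξ
    have := oscillator_energy_le ha ha' ha0 ha1 (hk ξ) (fun t => hdm t ξ)
      (fun t => hdm₁ t ξ) t
    rwa [im, im₁] at this
  have hdecay : ∀ (R : ℝ) (n : ℕ), ∃ C, ∀ t ξ, |t| ≤ R →
      |ξ| ^ n * ‖m t ξ‖ ≤ C ∧ |ξ| ^ n * ‖m₁ t ξ‖ ≤ C := by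
    intro R n
    obtain ⟨A, hA⟩ := hd₀ n
    obtain ⟨A', hA'⟩ := hd₀ (n + 1)
    obtain ⟨B, hB⟩ := hd₁ n
    obtain ⟨B', hB'⟩ := hd₁ (n + 1)
    -- The factor 1 + k in the energy bound costs one power of `ξ`, so decay of order `n` consumes
    -- data decay of orders `n` and `n + 1`.
    refine ⟨√(Real.exp R * ((A ^ 2 + B ^ 2) + (2 * Real.pi) ^ 2 * (A' ^ 2 + B' ^ 2))),
      fun t ξ ht => ?_⟩
    have hsq : |ξ| ^ (2 * n) * (‖m t ξ‖ ^ 2 + ‖m₁ t ξ‖ ^ 2) ≤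
        Real.exp R * ((A ^ 2 + B ^ 2) + (2 * Real.pi) ^ 2 * (A' ^ 2 + B' ^ 2)) := by
      calc |ξ| ^ (2 * n) * (‖m t ξ‖ ^ 2 + ‖m₁ t ξ‖ ^ 2)
          ≤ |ξ| ^ (2 * n) * (Real.exp |t| * (1 + k ξ) * (‖h₀ ξ‖ ^ 2 + ‖h₁ ξ‖ ^ 2)) := by
            gcongr; exact hen t ξ
        _ = Real.exp |t| * (((|ξ| ^ n * ‖h₀ ξ‖) ^ 2 + (|ξ| ^ n * ‖h₁ ξ‖) ^ 2) +
            (2 * Real.pi) ^ 2 *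
              ((|ξ| ^ (n + 1) * ‖h₀ ξ‖) ^ 2 + (|ξ| ^ (n + 1) * ‖h₁ ξ‖) ^ 2)) := by
            have : k ξ = (2 * Real.pi) ^ 2 * |ξ| ^ 2 := by simp [k, mul_pow]
            rw [this, pow_mul']
            ring
        _ ≤ _ := by
            gcongr
            exacts [hA ξ, hB ξ, hA' ξ, hB' ξ]
    constructor
    · refine Real.le_sqrt_of_sq_le (le_trans ?_ hsq)
      rw [mul_pow, ← pow_mul, mul_comm n 2]
      gcongr
      exact le_add_of_nonneg_right (sq_nonneg _)
    · refine Real.le_sqrt_of_sq_le (le_trans ?_ hsq)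
      rw [mul_pow, ← pow_mul, mul_comm n 2]
      gcongr
      exact le_add_of_nonneg_left (sq_nonneg _)
  have hkc : Continuous fun p : ℝ × ℝ => (p.1, k p.2) := by fun_prop
  have hc₀' : Continuous fun p : ℝ × ℝ => h₀ p.2 := hc₀.comp continuous_snd
  have hc₁' : Continuous fun p : ℝ × ℝ => h₁ p.2 := hc₁.comp continuous_snd
  refine ⟨m, m₁, ⟨?_, fun R n => ?_⟩, ⟨?_, fun R n => ?_⟩, hdm, fun t ξ => ?_, im, im₁,
    fun t ξ => ?_⟩
  · exact ((cσ₁.comp hkc).smul hc₀').add ((cρ₂.comp hkc).smul hc₁')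
  · obtain ⟨C, hC⟩ := hdecay R n
    exact ⟨C, fun t ξ ht => (hC t ξ ht).1⟩
  · have hk2 : Continuous fun p : ℝ × ℝ => -k p.2 := by fun_prop
    exact ((hk2.mul (continuous_const.mul (cρ₁.comp hkc))).smul hc₀').add
      ((continuous_const.mul (cσ₂.comp hkc)).smul hc₁')
  · obtain ⟨C, hC⟩ := hdecay R n
    exact ⟨C, fun t ξ ht => (hC t ξ ht).2⟩
  · refine (hdm₁ t ξ).congr_deriv ?_
    rw [Complex.real_smul]
    simp only [k]
    push_cast
    linear_combination (-(a t : ℂ) * (2 * Real.pi * ξ) ^ 2 * m t ξ) * Complex.I_sq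
  · exact (le_add_of_nonneg_right (sq_nonneg _)).trans (hen t ξ)

theorem lintegral_enorm_sq_fourierSynthesis {m : ℝ → ℝ → ℂ} (hm : IsRapidDensity m) (t : ℝ) :
    ∫⁻ x, ‖fourierSynthesis m t x‖ₑ ^ 2 = ∫⁻ ξ, ‖m t ξ‖ₑ ^ 2 :=
  lintegral_enorm_sq_fourierInv (hm.integrable t) (hm.memLp_two t)

/-- Existence for `u_tt = a(t) u_xx` with a nondecreasing coefficient `0 ≤ a ≤ 1`, together with
a Sobolev estimate whose constant does not depend on `a`. -/
theorem exists_wave_solution {a a' : ℝ → ℝ} (ha : ∀ t, HasDerivAt a (a' t) t)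
    (ha' : ∀ t, 0 ≤ a' t) (ha0 : ∀ t, 0 ≤ a t) (ha1 : ∀ t, a t ≤ 1) {g₀ g₁ : ℝ → ℂ}
    (hg₀ : ContDiff ℝ ∞ g₀) (hs₀ : HasCompactSupport g₀)
    (hg₁ : ContDiff ℝ ∞ g₁) (hs₁ : HasCompactSupport g₁) :
    ∃ u : ℝ → ℝ → ℂ, ContDiff ℝ 2 (fun p : ℝ × ℝ => u p.1 p.2) ∧
      (∀ t x, iteratedDeriv 2 (fun s => u s x) t = a t * iteratedDeriv 2 (u t) x) ∧
      (∀ x, u 0 x = g₀ x) ∧ (∀ x, deriv (fun s => u s x) 0 = g₁ x) ∧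
      ∀ t, sobolevNormSq 2 (u t) ≤ ENNReal.ofReal (2 * Real.exp |t|) *
        (sobolevNormSq 5 g₀ + sobolevNormSq 4 g₁) := by
  have hi₀ : Integrable g₀ := hg₀.continuous.integrable_of_hasCompactSupport hs₀
  have hi₁ : Integrable g₁ := hg₁.continuous.integrable_of_hasCompactSupport hs₁
  have hac : Continuous a := continuous_iff_continuousAt.2 fun t => (ha t).continuousAt
  obtain ⟨m, m₁, hm, hm₁, hd, hd₁, im, im₁, hbd⟩ := exists_wave_density ha ha' ha0 ha1
    (continuous_fourier_of_integrable hi₀) (continuous_fourier_of_integrable hi₁)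
    (exists_pow_mul_norm_fourier_le hg₀ hs₀) (exists_pow_mul_norm_fourier_le hg₁ hs₁)
  have hx := hm.mul_frequency
  have hxx := hx.mul_frequency
  have hm₂ := hxx.mul_left (b := fun t => (a t : ℂ)) (by fun_prop)
  have e1 : ∀ t, deriv (fourierSynthesis m t) = fourierSynthesis
      (fun t ξ => (2 * Real.pi * Complex.I * ξ) * m t ξ) t :=
    fun t => funext fun x => (hm.hasDerivAt_space t x).deriv
  have e2 : ∀ t, iteratedDeriv 2 (fourierSynthesis m t) = fourierSynthesis (fun t ξ =>
      (2 * Real.pi * Complex.I * ξ) * ((2 * Real.pi * Complex.I * ξ) * m t ξ)) t := by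
    intro t
    rw [iteratedDeriv_succ, iteratedDeriv_one, e1]
    exact funext fun x => (hx.hasDerivAt_space t x).deriv
  refine ⟨fourierSynthesis m, hm.contDiff_two hm₁ hm₂ hd hd₁, fun t x => ?_, fun x => ?_,
    fun x => ?_, fun t => ?_⟩
  · have f1 : deriv (fun s => fourierSynthesis m s x) = fun s => fourierSynthesis m₁ s x :=
      funext fun s => (hm.hasDerivAt_time hm₁ hd s x).deriv
    rw [iteratedDeriv_succ, iteratedDeriv_one, f1, (hm₁.hasDerivAt_time hm₂ hd₁ t x).deriv, e2,
      fourierSynthesis_eq, fourierSynthesis_eq, ← integral_const_mul]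
    exact integral_congr_ae (Eventually.of_forall fun ξ => by ring)
  · have hi := hm.integrable 0
    rw [im] at hi
    rw [fourierSynthesis, im, hg₀.continuous.fourierInv_fourier_eq hi₀ hi]
  · have hi := hm₁.integrable 0
    rw [im₁] at hi
    rw [(hm.hasDerivAt_time hm₁ hd 0 x).deriv, fourierSynthesis, im₁,
      hg₁.continuous.fourierInv_fourier_eq hi₁ hi]
  · let N : (ℝ → ℂ) → ℕ → ENNReal := fun g j => ∫⁻ x, ‖iteratedDeriv j g x‖ₑ ^ 2
    have hF : ∀ {h : ℝ → ℂ}, Integrable h → Measurable fun ξ => ‖𝓕 h ξ‖ₑ ^ 2 := fun hh =>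
      (continuous_fourier_of_integrable hh).measurable.enorm.pow_const 2
    have hw : ∀ j : ℕ, Measurable fun ξ : ℝ => ENNReal.ofReal ((2 * Real.pi * ξ) ^ (2 * j)) :=
      fun j => by fun_prop
    have hpt : ∀ (j : ℕ) (ξ : ℝ), ENNReal.ofReal ((2 * Real.pi * ξ) ^ (2 * j)) * ‖m t ξ‖ₑ ^ 2 ≤
        ENNReal.ofReal (Real.exp |t|) *
          ((ENNReal.ofReal ((2 * Real.pi * ξ) ^ (2 * j)) * ‖𝓕 g₀ ξ‖ₑ ^ 2 +
            ENNReal.ofReal ((2 * Real.pi * ξ) ^ (2 * (j + 1))) * ‖𝓕 g₀ ξ‖ₑ ^ 2) +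
          (ENNReal.ofReal ((2 * Real.pi * ξ) ^ (2 * j)) * ‖𝓕 g₁ ξ‖ₑ ^ 2 +
            ENNReal.ofReal ((2 * Real.pi * ξ) ^ (2 * (j + 1))) * ‖𝓕 g₁ ξ‖ₑ ^ 2)) := by
      intro j ξ
      have hp : ∀ i : ℕ, 0 ≤ (2 * Real.pi * ξ) ^ (2 * i) := fun i => by
        rw [pow_mul]; positivity
      have hn : ∀ z : ℂ, ‖z‖ₑ ^ 2 = ENNReal.ofReal (‖z‖ ^ 2) := fun z => by
        rw [← ofReal_norm, ENNReal.ofReal_pow (norm_nonneg _)]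
      have h1 := mul_nonneg (hp j) (sq_nonneg ‖𝓕 g₀ ξ‖)
      have h2 := mul_nonneg (hp (j + 1)) (sq_nonneg ‖𝓕 g₀ ξ‖)
      have h3 := mul_nonneg (hp j) (sq_nonneg ‖𝓕 g₁ ξ‖)
      have h4 := mul_nonneg (hp (j + 1)) (sq_nonneg ‖𝓕 g₁ ξ‖)
      simp only [hn]
      rw [← ENNReal.ofReal_mul (hp _), ← ENNReal.ofReal_mul (hp _), ← ENNReal.ofReal_mul (hp _),
        ← ENNReal.ofReal_mul (hp _), ← ENNReal.ofReal_mul (hp _), ← ENNReal.ofReal_add h1 h2,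
        ← ENNReal.ofReal_add h3 h4, ← ENNReal.ofReal_add (add_nonneg h1 h2) (add_nonneg h3 h4),
        ← ENNReal.ofReal_mul (Real.exp_pos _).le]
      refine ENNReal.ofReal_le_ofReal ?_
      calc (2 * Real.pi * ξ) ^ (2 * j) * ‖m t ξ‖ ^ 2 ≤ (2 * Real.pi * ξ) ^ (2 * j) *
            (Real.exp |t| * (1 + (2 * Real.pi * ξ) ^ 2) * (‖𝓕 g₀ ξ‖ ^ 2 + ‖𝓕 g₁ ξ‖ ^ 2)) :=
            mul_le_mul_of_nonneg_left (hbd t ξ) (hp j)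
        _ = _ := by rw [mul_add 2 j 1, pow_add]; ring
    have hj : ∀ j : ℕ, ∫⁻ ξ, ENNReal.ofReal ((2 * Real.pi * ξ) ^ (2 * j)) * ‖m t ξ‖ₑ ^ 2 ≤
        ENNReal.ofReal (Real.exp |t|) * ((N g₀ j + N g₀ (j + 1)) + (N g₁ j + N g₁ (j + 1))) := by
      intro j
      refine (lintegral_mono (hpt j)).trans (le_of_eq ?_)
      have := hF hi₀
      have := hF hi₁
      have := hw j
      have := hw (j + 1)
      rw [lintegral_const_mul _ (by fun_prop), lintegral_add_left (by fun_prop),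
        lintegral_add_left (by fun_prop), lintegral_add_left (by fun_prop)]
      simp only [N]
      rw [lintegral_enorm_sq_iteratedDeriv hg₀ hs₀, lintegral_enorm_sq_iteratedDeriv hg₀ hs₀,
        lintegral_enorm_sq_iteratedDeriv hg₁ hs₁, lintegral_enorm_sq_iteratedDeriv hg₁ hs₁]
    have hfreq : ∀ (ξ : ℝ) (z : ℂ), ‖(2 * Real.pi * Complex.I * ξ) * z‖ₑ ^ 2 =
        ENNReal.ofReal ((2 * Real.pi * ξ) ^ 2) * ‖z‖ₑ ^ 2 := by
      intro ξ z
      rw [enorm_mul, mul_pow]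
      congr 1
      rw [← ofReal_norm, ← ENNReal.ofReal_pow (norm_nonneg _)]
      congr 1
      simp [mul_pow]
    have d0 := hj 0
    have d1 := hj 1
    have d2 := hj 2
    have s0 : ∫⁻ x, ‖iteratedDeriv 0 (fourierSynthesis m t) x‖ₑ ^ 2 =
        ∫⁻ ξ, ENNReal.ofReal ((2 * Real.pi * ξ) ^ (2 * 0)) * ‖m t ξ‖ₑ ^ 2 := by
      simp [lintegral_enorm_sq_fourierSynthesis hm]
    have s1 : ∫⁻ x, ‖iteratedDeriv 1 (fourierSynthesis m t) x‖ₑ ^ 2 =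
        ∫⁻ ξ, ENNReal.ofReal ((2 * Real.pi * ξ) ^ (2 * 1)) * ‖m t ξ‖ₑ ^ 2 := by
      rw [iteratedDeriv_one, e1, lintegral_enorm_sq_fourierSynthesis hx]
      exact lintegral_congr fun ξ => hfreq _ _
    have s2 : ∫⁻ x, ‖iteratedDeriv 2 (fourierSynthesis m t) x‖ₑ ^ 2 =
        ∫⁻ ξ, ENNReal.ofReal ((2 * Real.pi * ξ) ^ (2 * 2)) * ‖m t ξ‖ₑ ^ 2 := by
      rw [e2, lintegral_enorm_sq_fourierSynthesis hxx]
      refine lintegral_congr fun ξ => ?_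
      rw [hfreq, hfreq, ← mul_assoc, ← ENNReal.ofReal_mul (sq_nonneg _), ← pow_add]
    -- Orders 0 to 2 and their shifts 1 to 3 are each part of the full sum, whence the factor 2.
    -- Only three derivatives of the data are really used.
    have hsum : ∀ (g : ℝ → ℂ) (n : ℕ), 4 ≤ n → ∑ j ∈ Finset.range 3, (N g j + N g (j + 1)) ≤
        2 * ∑ j ∈ Finset.range (n + 1), N g j := by
      intro g n hn
      rw [Finset.sum_add_distrib, two_mul]
      refine add_le_add (Finset.sum_le_sum_of_subset (Finset.range_mono (by omega))) ?_
      rw [Finset.sum_range_succ' (N g) n]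
      exact (Finset.sum_le_sum_of_subset (Finset.range_mono (by omega))).trans
        (self_le_add_right _ _)
    calc sobolevNormSq 2 (fourierSynthesis m t)
        ≤ ∑ j ∈ Finset.range 3, ENNReal.ofReal (Real.exp |t|) *
          ((N g₀ j + N g₀ (j + 1)) + (N g₁ j + N g₁ (j + 1))) := by
          refine Finset.sum_le_sum fun j hj' => ?_
          have := Finset.mem_range.1 hj'
          interval_cases j
          exacts [s0.le.trans d0, s1.le.trans d1, s2.le.trans d2]
      _ = ENNReal.ofReal (Real.exp |t|) * (∑ j ∈ Finset.range 3, (N g₀ j + N g₀ (j + 1)) +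
          ∑ j ∈ Finset.range 3, (N g₁ j + N g₁ (j + 1))) := by
          rw [← Finset.mul_sum, Finset.sum_add_distrib]
      _ ≤ ENNReal.ofReal (Real.exp |t|) * (2 * sobolevNormSq 5 g₀ + 2 * sobolevNormSq 4 g₁) := by
          gcongr
          exacts [hsum g₀ 5 (by norm_num), hsum g₁ 4 (by norm_num)]
      _ = _ := by
          rw [ENNReal.ofReal_mul (by norm_num), ENNReal.ofReal_ofNat]
          ring

/-! ### Cutoff and pointwise inequality for backward cones -/

/-- Squaring the positive part gives a C¹ cutoff that vanishes outside the cone, as the divergence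
theorem needs. -/
theorem hasDerivAt_sq_max_zero (r : ℝ) :
    HasDerivAt (fun r : ℝ => max r 0 ^ 2) (2 * max r 0) r := by
  refine hasDerivAt_of_hasDerivAt_of_ne' (f := fun r : ℝ => max r 0 ^ 2)
    (g := fun r : ℝ => 2 * max r 0) (x := 0) (fun y hy => ?_)
    (Continuous.continuousAt (by fun_prop)) (Continuous.continuousAt (by fun_prop)) r
  rcases lt_or_gt_of_ne hy with h | h
  · have e : (fun r : ℝ => max r 0 ^ 2) =ᶠ[𝓝 y] fun _ => (0 : ℝ) := by
      filter_upwards [Iio_mem_nhds h] with s hs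
      rw [max_eq_right (le_of_lt hs)]; simp
    rw [max_eq_right h.le, mul_zero]
    exact (hasDerivAt_const y (0 : ℝ)).congr_of_eventuallyEq e
  · have e : (fun r : ℝ => max r 0 ^ 2) =ᶠ[𝓝 y] fun s => s ^ 2 := by
      filter_upwards [Ioi_mem_nhds h] with s hs
      rw [max_eq_left (le_of_lt hs)]
    rw [max_eq_left h.le]
    exact ((hasDerivAt_pow 2 y).congr_of_eventuallyEq e).congr_deriv (by simp)

/-- This function replaces |x| in the cone: it is differentiable at the origin and has slope at most
1 in absolute value. -/
theorem hasDerivAt_sqrt_one_add_sq (x : ℝ) :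
    HasDerivAt (fun x : ℝ => √(1 + x ^ 2)) (x / √(1 + x ^ 2)) x := by
  have h : HasDerivAt (fun x : ℝ => 1 + x ^ 2) (2 * x) x := by
    simpa using (hasDerivAt_pow 2 x).const_add 1
  refine (h.sqrt (by positivity)).congr_deriv ?_
  rw [mul_div_mul_left _ _ two_ne_zero]

theorem abs_div_sqrt_one_add_sq_le (x : ℝ) : |x / √(1 + x ^ 2)| ≤ 1 := by
  rw [abs_div, abs_of_nonneg (Real.sqrt_nonneg _)]
  refine div_le_one_of_le₀ (Real.abs_le_sqrt (by linarith)) (Real.sqrt_nonneg _)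

/-- The pointwise inequality behind the energy estimate on backward cones of speed `2`. -/
theorem cone_divergence_le {a a' δ θ r s p q Qx K L : ℝ} (ha0 : 0 ≤ a) (ha1 : a ≤ 1)
    (ha' : 0 ≤ a') (hδ : 0 < δ) (hδ1 : δ ≤ 1) (hθ : 0 ≤ θ) (hθL : θ ≤ L) (hr : 0 ≤ r)
    (hs : |s| ≤ 1) (hK0 : 0 ≤ K) (hK : 2 * |p * Qx| ≤ K * a) :
    θ * (2 * p / (a + δ) * (a * Qx) - p ^ 2 * a' / (a + δ) ^ 2 - 2 * p * Qx) -
      (p ^ 2 / (a + δ) + q ^ 2) * (4 * r) + 4 * r * s * (p * q) ≤ L * (K * δ) := by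
  have hd : 0 < a + δ := by linarith
  have h1 : 2 * p / (a + δ) * (a * Qx) - p ^ 2 * a' / (a + δ) ^ 2 - 2 * p * Qx ≤
      K * a / (a + δ) * δ := by
    have e : 2 * p / (a + δ) * (a * Qx) - p ^ 2 * a' / (a + δ) ^ 2 - 2 * p * Qx =
        -(2 * (p * Qx)) / (a + δ) * δ - p ^ 2 * a' / (a + δ) ^ 2 := by field_simp; ring
    rw [e]
    have h2 : 0 ≤ p ^ 2 * a' / (a + δ) ^ 2 := by positivity
    have h3 : -(2 * (p * Qx)) ≤ K * a := by linarith [neg_abs_le (p * Qx)]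
    have h4 : -(2 * (p * Qx)) / (a + δ) * δ ≤ K * a / (a + δ) * δ := by gcongr
    linarith
  have h5 : 0 ≤ K * a / (a + δ) * δ := by positivity
  have h6 : θ * (K * a / (a + δ) * δ) ≤ L * (K * δ) := by
    have h9 : K * a / (a + δ) ≤ K := by
      rw [div_le_iff₀ hd]
      exact mul_le_mul_of_nonneg_left (by linarith) hK0
    exact mul_le_mul hθL (mul_le_mul_of_nonneg_right h9 hδ.le) h5 (hθ.trans hθL)
  -- Here a + δ ≤ 2; cone speed 2 is then enough for the flux 2pq to be absorbed by the energy
  -- density.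
  have h7 : p ^ 2 / 2 ≤ p ^ 2 / (a + δ) := by gcongr; linarith
  have h8 : s * (p * q) ≤ p ^ 2 / (a + δ) + q ^ 2 := by
    have h9 : s * (p * q) ≤ |p * q| := by
      refine (le_abs_self _).trans ?_
      rw [abs_mul]
      exact mul_le_of_le_one_left (abs_nonneg _) hs
    rw [abs_mul] at h9
    nlinarith [sq_nonneg (|p| - |q|), sq_abs p, sq_abs q, sq_nonneg q]
  nlinarith [mul_le_mul_of_nonneg_left h1 hθ, mul_le_mul_of_nonneg_left h8 hr]

/-! ### Uniqueness on the closed strip -/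

section Strip

variable {T : ℝ}

theorem uniqueDiffOn_strip (hT : 0 < T) : UniqueDiffOn ℝ (Icc 0 T ×ˢ (univ : Set ℝ)) :=
  (uniqueDiffOn_Icc hT).prod uniqueDiffOn_univ

theorem strip_mem_nhds {z : ℝ × ℝ} (hz : z.1 ∈ Ioo 0 T) :
    Icc 0 T ×ˢ (univ : Set ℝ) ∈ 𝓝 z :=
  prod_mem_nhds (Icc_mem_nhds hz.1 hz.2) univ_mem

theorem hasDerivWithinAt_strip_time {E : Type*} [NormedAddCommGroup E] [NormedSpace ℝ E]
    {h : ℝ × ℝ → E} {h' : ℝ × ℝ →L[ℝ] E} {t x : ℝ}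
    (hh : HasFDerivWithinAt h h' (Icc 0 T ×ˢ univ) (t, x)) :
    HasDerivWithinAt (fun s => h (s, x)) (h' (1, 0)) (Icc 0 T) t := by
  have hmaps : MapsTo (fun s : ℝ => (s, x)) (Icc 0 T) (Icc 0 T ×ˢ univ) :=
    fun _ hs => ⟨hs, mem_univ _⟩
  exact hh.comp_hasDerivWithinAt t
    ((hasDerivAt_id t).prodMk (hasDerivAt_const t x)).hasDerivWithinAt hmaps

theorem hasDerivAt_strip_space {E : Type*} [NormedAddCommGroup E] [NormedSpace ℝ E]
    {h : ℝ × ℝ → E} {h' : ℝ × ℝ →L[ℝ] E} {t x : ℝ} (ht : t ∈ Icc 0 T)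
    (hh : HasFDerivWithinAt h h' (Icc 0 T ×ˢ univ) (t, x)) :
    HasDerivAt (fun y => h (t, y)) (h' (0, 1)) x := by
  rw [← hasDerivWithinAt_univ]
  exact hh.comp_hasDerivWithinAt x
    ((hasDerivAt_const x t).prodMk (hasDerivAt_id x)).hasDerivWithinAt
    fun _ _ => ⟨ht, mem_univ _⟩

theorem abs_sub_le_of_hasDerivWithinAt {h h' : ℝ → ℝ} {t C : ℝ} (ht : t ∈ Icc 0 T)
    (hd : ∀ s ∈ Icc 0 T, HasDerivWithinAt h (h' s) (Icc 0 T) s)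
    (hC : ∀ s ∈ Icc 0 t, |h' s| ≤ C) : |h t - h 0| ≤ C * t := by
  have hsub : Icc 0 t ⊆ Icc 0 T := Icc_subset_Icc_right ht.2
  have := (convex_Icc 0 t).norm_image_sub_le_of_norm_hasDerivWithin_le
    (fun s hs => (hd s (hsub hs)).mono hsub) hC ⟨le_rfl, ht.1⟩ ⟨ht.1, le_rfl⟩
  simpa [abs_of_nonneg ht.1] using this

variable {a a' : ℝ → ℝ}

/-- Energy argument on backward cones for the first order form of `w_tt = a(t) w_xx`, with
`p = w_t` and `q = w_x`. -/
theorem strip_space_deriv_eq_zero (ha : ∀ t, HasDerivAt a (a' t) t)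
    (hac' : Continuous a') (ha' : ∀ t, 0 ≤ a' t) (ha0 : ∀ t, 0 ≤ a t) (ha1 : ∀ t, a t ≤ 1)
    {p q : ℝ × ℝ → ℝ} {P Q : ℝ × ℝ → ℝ × ℝ →L[ℝ] ℝ}
    (hp : ∀ z ∈ Icc 0 T ×ˢ univ, HasFDerivWithinAt p (P z) (Icc 0 T ×ˢ univ) z)
    (hq : ∀ z ∈ Icc 0 T ×ˢ univ, HasFDerivWithinAt q (Q z) (Icc 0 T ×ˢ univ) z)
    (hPc : ContinuousOn P (Icc 0 T ×ˢ univ)) (hQc : ContinuousOn Q (Icc 0 T ×ˢ univ))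
    (hsymm : ∀ z ∈ Icc 0 T ×ˢ univ, P z (0, 1) = Q z (1, 0))
    (hpde : ∀ z ∈ Icc 0 T ×ˢ univ, P z (1, 0) = a z.1 * Q z (0, 1))
    (hp0 : ∀ x, p (0, x) = 0) (hq0 : ∀ x, q (0, x) = 0) {t₀ x₀ : ℝ} (ht₀ : t₀ ∈ Icc 0 T) :
    q (t₀, x₀) = 0 := by
  rcases eq_or_lt_of_le ht₀.1 with h0 | h0
  · rw [← h0, hq0]
  by_contra hne
  have hamono : Monotone a := monotone_of_hasDerivAt_nonneg ha ha'
  have hac : Continuous a := continuous_iff_continuousAt.2 fun t => (ha t).continuousAt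
  have hpc : ContinuousOn p (Icc 0 T ×ˢ univ) := fun z hz => (hp z hz).continuousWithinAt
  have hqc : ContinuousOn q (Icc 0 T ×ˢ univ) := fun z hz => (hq z hz).continuousWithinAt
  -- Chosen so that the defining function `ρ` of the cone equals 1 at `(t₀, x₀)`.
  let R : ℝ := 2 * t₀ + √(1 + x₀ ^ 2) + 1
  have hR : 0 < R := by positivity
  have hx₀ : |x₀| < R := by
    have : |x₀| ≤ √(1 + x₀ ^ 2) := Real.abs_le_sqrt (by linarith)
    simp only [R]; linarith
  let B : Set (ℝ × ℝ) := Icc (0, -R) (t₀, R)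
  have hB : B = Icc 0 t₀ ×ˢ Icc (-R) R := Icc_prod_eq _ _
  have hBS : B ⊆ Icc 0 T ×ˢ univ := by
    rw [hB]; exact prod_mono (Icc_subset_Icc_right ht₀.2) (subset_univ _)
  have hBc : IsCompact B := isCompact_Icc
  obtain ⟨M, hM⟩ : ∃ M, ∀ z ∈ B, ‖Q z (0, 1)‖ ≤ M :=
    hBc.exists_bound_of_continuousOn ((hQc.mono hBS).clm_apply continuousOn_const)
  have hM0 : 0 ≤ M := (norm_nonneg _).trans
    (hM (0, 0) (by rw [hB]; exact ⟨⟨le_rfl, h0.le⟩, by constructor <;> simp [hR.le]⟩))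
  -- The decisive bound: `p` vanishes at least as fast as `a`. It follows by integrating p_t = a q_x
  -- from time 0, with `a s ≤ a t` for s ≤ t.
  have hpb : ∀ z ∈ B, |p z| ≤ a z.1 * M * t₀ := by
    rintro ⟨t, x⟩ hz
    have hz' := hz
    rw [hB] at hz'
    have ht : t ∈ Icc 0 T := (hBS hz).1
    have := abs_sub_le_of_hasDerivWithinAt (h := fun s => p (s, x)) (C := a t * M) ht
      (fun s hs => hasDerivWithinAt_strip_time (hp (s, x) ⟨hs, mem_univ _⟩)) fun s hs => by
        have hs' : (s, x) ∈ B := by rw [hB]; exact ⟨⟨hs.1, hs.2.trans hz'.1.2⟩, hz'.2⟩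
        rw [hpde _ (hBS hs'), abs_mul, abs_of_nonneg (ha0 _)]
        exact mul_le_mul (hamono hs.2) (hM _ hs') (abs_nonneg _) (ha0 _)
    rw [hp0, sub_zero] at this
    exact this.trans (mul_le_mul_of_nonneg_left hz'.1.2 (mul_nonneg (ha0 _) hM0))
  let ρ : ℝ × ℝ → ℝ := fun z => R - 2 * z.1 - √(1 + z.2 ^ 2)
  let θ : ℝ × ℝ → ℝ := fun z => max (ρ z) 0 ^ 2
  let θ' : ℝ × ℝ → ℝ × ℝ →L[ℝ] ℝ := fun z => (2 * max (ρ z) 0) •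
    (-((2 : ℝ) • ContinuousLinearMap.fst ℝ ℝ ℝ) -
      (z.2 / √(1 + z.2 ^ 2)) • ContinuousLinearMap.snd ℝ ℝ ℝ)
  have hρ : ∀ z, HasFDerivAt ρ (-((2 : ℝ) • ContinuousLinearMap.fst ℝ ℝ ℝ) -
      (z.2 / √(1 + z.2 ^ 2)) • ContinuousLinearMap.snd ℝ ℝ ℝ) z := fun z =>
    ((hasFDerivAt_fst.const_mul 2).const_sub R).sub
      ((hasDerivAt_sqrt_one_add_sq z.2).comp_hasFDerivAt z hasFDerivAt_snd)
  have hθ : ∀ z, HasFDerivAt θ (θ' z) z := fun z =>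
    (hasDerivAt_sq_max_zero (ρ z)).comp_hasFDerivAt z (hρ z)
  have hρc : Continuous ρ := by fun_prop
  have hθc : Continuous θ := by fun_prop
  have hsqrt : ∀ x : ℝ, √(1 + x ^ 2) ≠ 0 := fun x => by positivity
  have hθc' : Continuous θ' := by
    have : Continuous fun z : ℝ × ℝ => z.2 / √(1 + z.2 ^ 2) :=
      Continuous.div (by fun_prop) (by fun_prop) fun z => hsqrt z.2
    fun_prop
  have hθ0 : ∀ z, 0 ≤ θ z := fun z => sq_nonneg _
  have hθb : ∀ z ∈ B, θ z ≤ R ^ 2 := by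
    intro z hz
    rw [hB] at hz
    have : ρ z ≤ R := by
      have := hz.1.1
      have := Real.sqrt_nonneg (1 + z.2 ^ 2)
      simp only [ρ]; linarith
    exact pow_le_pow_left₀ (le_max_right _ _) (max_le this hR.le) 2
  -- The cutoff vanishes on the lateral sides of the box, so only the top and bottom contribute to
  -- the divergence theorem.
  have hθside : ∀ t x, 0 ≤ t → |x| = R → θ (t, x) = 0 := by
    intro t x ht hx
    have : R ≤ √(1 + x ^ 2) := by rw [← hx]; exact Real.abs_le_sqrt (by linarith)
    have : ρ (t, x) ≤ 0 := by simp only [ρ]; linarith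
    simp only [θ, max_eq_right this]; simp
  let K : ℝ := 2 * M ^ 2 * t₀
  let L : ℝ := R ^ 2
  have hestimate : ∀ δ : ℝ, 0 < δ → δ ≤ 1 →
      ∫ y in (-R)..R, θ (t₀, y) * q (t₀, y) ^ 2 ≤ L * (K * δ) * volume.real B := by
    intro δ hδ hδ1
    have hd : ∀ t, 0 < a t + δ := fun t => add_pos_of_nonneg_of_pos (ha0 t) hδ
    -- Localised energy density `f` and flux `g`; in ∂_t f + ∂_x g the terms q q_t and q p_x cancel
    -- by symmetry of the mixed derivatives.
    let f : ℝ × ℝ → ℝ := fun z => θ z * (p z ^ 2 / (a z.1 + δ) + q z ^ 2)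
    let g : ℝ × ℝ → ℝ := fun z => -(θ z * (2 * (p z * q z)))
    let f' : ℝ × ℝ → ℝ × ℝ →L[ℝ] ℝ := fun z =>
      θ z • ((2 * p z / (a z.1 + δ)) • P z -
        (p z ^ 2 * a' z.1 / (a z.1 + δ) ^ 2) • ContinuousLinearMap.fst ℝ ℝ ℝ +
        (2 * q z) • Q z) + (p z ^ 2 / (a z.1 + δ) + q z ^ 2) • θ' z
    let g' : ℝ × ℝ → ℝ × ℝ →L[ℝ] ℝ := fun z =>
      -(θ z • ((2 * p z) • Q z + (2 * q z) • P z) + (2 * (p z * q z)) • θ' z)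
    have hpB := hpc.mono hBS
    have hqB := hqc.mono hBS
    have hPB := hPc.mono hBS
    have hQB := hQc.mono hBS
    have hden : ContinuousOn (fun z : ℝ × ℝ => a z.1 + δ) B :=
      Continuous.continuousOn (by fun_prop)
    have hden0 : ∀ z ∈ B, a z.1 + δ ≠ 0 := fun z _ => (hd z.1).ne'
    have hden2 : ∀ z ∈ B, (a z.1 + δ) ^ 2 ≠ 0 := fun z _ => pow_ne_zero 2 (hd z.1).ne'
    have hfc : ContinuousOn f B :=
      hθc.continuousOn.mul (((hpB.pow 2).div hden hden0).add (hqB.pow 2))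
    have hgc : ContinuousOn g B :=
      (hθc.continuousOn.mul (continuousOn_const.mul (hpB.mul hqB))).neg
    have hac'' : ContinuousOn (fun z : ℝ × ℝ => a' z.1) B :=
      Continuous.continuousOn (by fun_prop)
    have hfc' : ContinuousOn f' B := by
      refine (hθc.continuousOn.smul ((((((continuousOn_const.mul hpB).div hden hden0).smul
        hPB).sub ((((hpB.pow 2).mul hac'').div (hden.pow 2) hden2).smul
          continuousOn_const)).add ((continuousOn_const.mul hqB).smul hQB)))).add
        ((((hpB.pow 2).div hden hden0).add (hqB.pow 2)).smul hθc'.continuousOn)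
    have hgc' : ContinuousOn g' B :=
      ((hθc.continuousOn.smul (((continuousOn_const.mul hpB).smul hQB).add
        ((continuousOn_const.mul hqB).smul hPB))).add
        ((continuousOn_const.mul (hpB.mul hqB)).smul hθc'.continuousOn)).neg
    have hint : IntegrableOn (fun z => f' z (1, 0) + g' z (0, 1)) B :=
      ((hfc'.clm_apply continuousOn_const).add
        (hgc'.clm_apply continuousOn_const)).integrableOn_compact hBc
    have hin : ∀ z ∈ Ioo (0 : ℝ) t₀ ×ˢ Ioo (-R) R \ (∅ : Set (ℝ × ℝ)),
        HasFDerivAt p (P z) z ∧ HasFDerivAt q (Q z) z := by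
      intro z hz
      have hz1 : z.1 ∈ Ioo 0 T := ⟨hz.1.1.1, hz.1.1.2.trans_le ht₀.2⟩
      have hzS : z ∈ Icc 0 T ×ˢ (univ : Set ℝ) := ⟨⟨hz1.1.le, hz1.2.le⟩, mem_univ _⟩
      exact ⟨(hp z hzS).hasFDerivAt (strip_mem_nhds hz1),
        (hq z hzS).hasFDerivAt (strip_mem_nhds hz1)⟩
    have hdiv := integral_divergence_prod_Icc_of_hasFDerivAt_off_countable_of_le f g f' g'
      (0, -R) (t₀, R) (Prod.mk_le_mk.2 ⟨h0.le, by linarith⟩) ∅ countable_empty hfc hgc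
      (fun z hz => ?_) (fun z hz => ?_) hint
    rotate_left
    · obtain ⟨hpz, hqz⟩ := hin z hz
      have haz : HasFDerivAt (fun z : ℝ × ℝ => (a z.1 + δ)⁻¹)
          ((-a' z.1 / (a z.1 + δ) ^ 2) • ContinuousLinearMap.fst ℝ ℝ ℝ) z :=
        (((ha z.1).add_const δ).inv (hd z.1).ne').comp_hasFDerivAt z hasFDerivAt_fst
      have h1 := (hθ z).mul (((hpz.pow 2).mul haz).add (hqz.pow 2))
      simp only [f, div_eq_mul_inv]
      refine h1.congr_fderiv ?_
      have := (hd z.1).ne'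
      ext <;> simp [f'] <;> field_simp
      ring
    · obtain ⟨hpz, hqz⟩ := hin z hz
      refine ((hθ z).mul ((hpz.mul hqz).const_mul 2)).neg.congr_fderiv ?_
      ext <;> (simp [g']; ring)
    have hle : ∫ z in B, f' z (1, 0) + g' z (0, 1) ≤ ∫ _ in B, L * (K * δ) := by
      refine setIntegral_mono_on hint (integrableOn_const hBc.measure_ne_top)
        measurableSet_Icc fun z hz => ?_
      have e : f' z (1, 0) + g' z (0, 1) =
          θ z * (2 * p z / (a z.1 + δ) * (a z.1 * Q z (0, 1)) -
            p z ^ 2 * a' z.1 / (a z.1 + δ) ^ 2 - 2 * p z * Q z (0, 1)) -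
          (p z ^ 2 / (a z.1 + δ) + q z ^ 2) * (4 * max (ρ z) 0) +
          4 * max (ρ z) 0 * (z.2 / √(1 + z.2 ^ 2)) * (p z * q z) := by
        rw [← hpde z (hBS hz)]
        simp only [f', g', θ', add_apply, neg_apply, sub_apply, smul_apply, smul_eq_mul,
          ContinuousLinearMap.coe_fst', ContinuousLinearMap.coe_snd', hsymm z (hBS hz)]
        ring
      rw [e]
      refine cone_divergence_le (ha0 _) (ha1 _) (ha' _) hδ hδ1 (hθ0 z) (hθb z hz)
        (le_max_right _ _) (abs_div_sqrt_one_add_sq_le _) (by positivity) ?_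
      rw [abs_mul]
      calc 2 * (|p z| * |Q z (0, 1)|) ≤ 2 * ((a z.1 * M * t₀) * M) := by
            have := mul_le_mul (hpb z hz) (hM z hz) (norm_nonneg _)
              (by have := ha0 z.1; positivity)
            rw [Real.norm_eq_abs] at this
            linarith
        _ = K * a z.1 := by simp only [K]; ring
    rw [setIntegral_const, smul_eq_mul, mul_comm] at hle
    have hs1 : ∫ x in (0 : ℝ)..t₀, g (x, R) = 0 := by
      rw [intervalIntegral.integral_congr (g := fun _ => (0 : ℝ))]
      · simp
      · intro x hx
        rw [uIcc_of_le h0.le] at hx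
        simp [g, hθside x R hx.1 (abs_of_pos hR)]
    have hs2 : ∫ x in (0 : ℝ)..t₀, g (x, -R) = 0 := by
      rw [intervalIntegral.integral_congr (g := fun _ => (0 : ℝ))]
      · simp
      · intro x hx
        rw [uIcc_of_le h0.le] at hx
        simp [g, hθside x (-R) hx.1 (by rw [abs_neg, abs_of_pos hR])]
    have hs3 : ∫ y in (-R)..R, f (0, y) = 0 := by
      simp [f, hp0, hq0]
    simp only at hdiv
    rw [hs1, hs2, hs3] at hdiv
    have hslice : ContinuousOn (fun y => ((t₀, y) : ℝ × ℝ)) (uIcc (-R) R) :=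
      Continuous.continuousOn (by fun_prop)
    have hmaps : MapsTo (fun y => ((t₀, y) : ℝ × ℝ)) (uIcc (-R) R) B := fun y hy => by
      rw [uIcc_of_le (by linarith)] at hy
      rw [hB]; exact ⟨⟨h0.le, le_rfl⟩, hy⟩
    -- The nonnegative p² part is dropped, leaving a left side independent of `δ`.
    have hfinal : ∫ y in (-R)..R, θ (t₀, y) * q (t₀, y) ^ 2 ≤ ∫ y in (-R)..R, f (t₀, y) := by
      refine intervalIntegral.integral_mono_on (by linarith)
        ((hθc.continuousOn.mul (hqB.pow 2)).comp hslice hmaps).intervalIntegrable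
        (hfc.comp hslice hmaps).intervalIntegrable fun y _ => ?_
      have := (hd t₀).le
      exact mul_le_mul_of_nonneg_left (le_add_of_nonneg_left (by positivity)) (hθ0 _)
    linarith
  have hlim : ∫ y in (-R)..R, θ (t₀, y) * q (t₀, y) ^ 2 ≤ 0 := by
    have htend : Tendsto (fun δ : ℝ => L * (K * δ) * volume.real B) (𝓝[>] 0) (𝓝 0) := by
      have : Tendsto (fun δ : ℝ => L * (K * δ) * volume.real B) (𝓝 0)
          (𝓝 (L * (K * 0) * volume.real B)) := Continuous.tendsto (by fun_prop) 0
      simp only [mul_zero, zero_mul] at this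
      exact this.mono_left nhdsWithin_le_nhds
    refine ge_of_tendsto htend ?_
    filter_upwards [Ioc_mem_nhdsGT one_pos] with δ hδ using hestimate δ hδ.1 hδ.2
  -- If `q` were nonzero at `(t₀, x₀)`, the continuous nonnegative integrand would be positive
  -- there, hence so would its integral.
  refine absurd hlim (not_le.2 (intervalIntegral.integral_pos (by linarith) ?_ ?_ ?_))
  · refine hθc.continuousOn.comp (Continuous.continuousOn (by fun_prop))
      (mapsTo_univ _ _) |>.mul (ContinuousOn.pow (hqc.comp (Continuous.continuousOn (by fun_prop))
        fun y _ => ⟨ht₀, mem_univ _⟩) 2)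
  · exact fun y _ => mul_nonneg (hθ0 _) (sq_nonneg _)
  · refine ⟨x₀, ⟨(abs_lt.1 hx₀).1.le, (abs_lt.1 hx₀).2.le⟩, ?_⟩
    have : ρ (t₀, x₀) = 1 := by simp only [ρ, R]; ring
    simp only [θ, this]
    positivity

/-- Uniqueness for `w_tt = a(t) w_xx` on a closed strip, for real functions of class `C²`. -/
theorem strip_wave_eq_zero (hT : 0 < T) (ha : ∀ t, HasDerivAt a (a' t) t)
    (hac' : Continuous a') (ha' : ∀ t, 0 ≤ a' t) (ha0 : ∀ t, 0 ≤ a t) (ha1 : ∀ t, a t ≤ 1)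
    {w : ℝ → ℝ → ℝ} (hw : ContDiffOn ℝ 2 (fun z : ℝ × ℝ => w z.1 z.2) (Icc 0 T ×ˢ univ))
    (hpde : ∀ t ∈ Icc 0 T, ∀ x, iteratedDerivWithin 2 (fun s => w s x) (Icc 0 T) t =
      a t * iteratedDeriv 2 (w t) x)
    (hw0 : ∀ x, w 0 x = 0) (hw1 : ∀ x, derivWithin (fun s => w s x) (Icc 0 T) 0 = 0)
    {t x : ℝ} (ht : t ∈ Icc 0 T) : w t x = 0 := by
  let S : Set (ℝ × ℝ) := Icc 0 T ×ˢ univ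
  have hS : UniqueDiffOn ℝ S := uniqueDiffOn_strip hT
  let W : ℝ × ℝ → ℝ := fun z => w z.1 z.2
  let D := fderivWithin ℝ W S
  let D₂ := fderivWithin ℝ D S
  have hDc : ContDiffOn ℝ 1 D S := hw.fderivWithin hS (by norm_num)
  have hWD : ∀ z ∈ S, HasFDerivWithinAt W (D z) S z := fun z hz =>
    (hw.differentiableOn (by norm_num) z hz).hasFDerivWithinAt
  have hDD : ∀ z ∈ S, HasFDerivWithinAt D (D₂ z) S z := fun z hz =>
    (hDc.differentiableOn (by norm_num) z hz).hasFDerivWithinAt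
  have hD₂c : ContinuousOn D₂ S := hDc.continuousOn_fderivWithin hS (by norm_num)
  -- Flipping the second derivative exhibits it as the derivative of the directional derivative
  -- along the fixed vector `v`.
  have happ : ∀ v : ℝ × ℝ, ∀ z ∈ S,
      HasFDerivWithinAt (fun z => D z v) ((D₂ z).flip v) S z := fun v z hz =>
    ((hDD z hz).clm_apply (hasFDerivWithinAt_const v z S)).congr_fderiv (by ext <;> simp)
  have hflip : ∀ v : ℝ × ℝ, ContinuousOn (fun z => (D₂ z).flip v) S := fun v =>
    ((ContinuousLinearMap.flipₗᵢ ℝ (ℝ × ℝ) (ℝ × ℝ) ℝ).continuous.comp_continuousOn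
      hD₂c).clm_apply continuousOn_const
  have hdw : ∀ s ∈ Icc 0 T, ∀ x, derivWithin (fun s => w s x) (Icc 0 T) s = D (s, x) (1, 0) :=
    fun s hs x => (hasDerivWithinAt_strip_time (hWD (s, x) ⟨hs, mem_univ _⟩)).derivWithin
      (uniqueDiffOn_Icc hT s hs)
  have hds : ∀ s ∈ Icc 0 T, ∀ x, HasDerivAt (w s) (D (s, x) (0, 1)) x :=
    fun s hs x => hasDerivAt_strip_space hs (hWD (s, x) ⟨hs, mem_univ _⟩)
  have hz0 : (0 : ℝ) ∈ Icc 0 T := ⟨le_rfl, hT.le⟩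
  have hP : ∀ z ∈ S, (D₂ z).flip (1, 0) (1, 0) = a z.1 * (D₂ z).flip (0, 1) (0, 1) := by
    rintro ⟨s, x⟩ hz
    have h1 : iteratedDerivWithin 2 (fun s => w s x) (Icc 0 T) s =
        (D₂ (s, x)).flip (1, 0) (1, 0) := by
      rw [iteratedDerivWithin_succ, iteratedDerivWithin_one,
        derivWithin_congr (fun r hr => hdw r hr x) (hdw s hz.1 x)]
      exact (hasDerivWithinAt_strip_time (happ (1, 0) (s, x) hz)).derivWithin
        (uniqueDiffOn_Icc hT s hz.1)
    have h2 : iteratedDeriv 2 (w s) x = (D₂ (s, x)).flip (0, 1) (0, 1) := by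
      rw [iteratedDeriv_succ, iteratedDeriv_one, show deriv (w s) = fun y => D (s, y) (0, 1) from
        funext fun y => (hds s hz.1 y).deriv]
      exact (hasDerivAt_strip_space hz.1 (happ (0, 1) (s, x) hz)).deriv
    rw [← h1, ← h2, hpde s hz.1 x]
  -- Second derivatives within `S` are symmetric up to the boundary because every point of `S` is a
  -- limit of interior points.
  have hcl : S ⊆ closure (interior S) := by
    rw [interior_prod_eq, interior_Icc, interior_univ, closure_prod_eq, closure_Ioo hT.ne,
      closure_univ]
  have hsymm : ∀ z ∈ S, (D₂ z).flip (1, 0) (0, 1) = (D₂ z).flip (0, 1) (1, 0) := fun z hz =>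
    (hw z hz).isSymmSndFDerivWithinAt (by simp) hS (hcl hz) hz (0, 1) (1, 0)
  have hp0 : ∀ x, D (0, x) (1, 0) = 0 := fun x => by rw [← hdw 0 hz0, hw1]
  have hq0 : ∀ x, D (0, x) (0, 1) = 0 := fun x =>
    (hds 0 hz0 x).unique ((funext hw0 : w 0 = fun _ => 0) ▸ hasDerivAt_const x (0 : ℝ))
  -- Once w_x = 0, the equation gives w_tt = 0, and the zero data propagate along each vertical
  -- line.
  have hq : ∀ s ∈ Icc 0 T, ∀ x, D (s, x) (0, 1) = 0 := fun s hs x =>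
    strip_space_deriv_eq_zero ha hac' ha' ha0 ha1 (happ (1, 0)) (happ (0, 1)) (hflip _)
      (hflip _) hsymm hP hp0 hq0 hs
  have hconst : ∀ s ∈ Icc 0 T, w s x = w s 0 := fun s hs =>
    is_const_of_deriv_eq_zero (fun y => (hds s hs y).differentiableAt)
      (fun y => by rw [(hds s hs y).deriv, hq s hs y]) x 0
  have hp : ∀ s ∈ Icc 0 T, D (s, x) (1, 0) = 0 := by
    intro s hs
    have := abs_sub_le_of_hasDerivWithinAt (h := fun r => D (r, x) (1, 0)) (C := 0) hs
      (fun r hr => hasDerivWithinAt_strip_time (happ (1, 0) (r, x) ⟨hr, mem_univ _⟩))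
      fun r hr => by
        have hr' : r ∈ Icc 0 T := ⟨hr.1, hr.2.trans hs.2⟩
        have e : (D₂ (r, x)).flip (0, 1) (0, 1) = 0 :=
          (hasDerivAt_strip_space hr' (happ (0, 1) (r, x) ⟨hr', mem_univ _⟩)).unique
            ((funext (hq r hr') : (fun y => D (r, y) (0, 1)) = fun _ => 0) ▸
              hasDerivAt_const x (0 : ℝ))
        rw [hP _ ⟨hr', mem_univ _⟩, e]
        simp
    rw [hp0, sub_zero, zero_mul] at this
    exact abs_nonpos_iff.1 this
  have := abs_sub_le_of_hasDerivWithinAt (h := fun r => w r x) (C := 0) ht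
    (fun r hr => hasDerivWithinAt_strip_time (hWD (r, x) ⟨hr, mem_univ _⟩))
    fun r hr => by rw [hp r ⟨hr.1, hr.2.trans ht.2⟩, abs_zero]
  rw [hw0, sub_zero, zero_mul] at this
  exact abs_nonpos_iff.1 this

end Strip

/-! ### The regularised Heaviside function as a distribution function -/

namespace IsNonnegMollifier

variable {φ : ℝ → ℝ} {ε : ℝ}

theorem continuous_scaledMollifier (hφ : IsNonnegMollifier φ) :
    Continuous (scaledMollifier φ ε) := by
  have := hφ.smooth.continuous
  unfold scaledMollifier
  fun_prop

theorem scaledMollifier_nonneg (hφ : IsNonnegMollifier φ) (hε : 0 < ε) (t : ℝ) :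
    0 ≤ scaledMollifier φ ε t :=
  mul_nonneg (by positivity) (hφ.nonneg _)

theorem integrable_scaledMollifier (hφ : IsNonnegMollifier φ) (hε : 0 < ε) :
    Integrable (scaledMollifier φ ε) :=
  ((hφ.smooth.continuous.integrable_of_hasCompactSupport hφ.compactSupport).comp_div
    hε.ne').const_mul _

theorem integral_scaledMollifier (hφ : IsNonnegMollifier φ) (hε : 0 < ε) :
    ∫ t, scaledMollifier φ ε t = 1 := by
  simp only [scaledMollifier]
  rw [integral_const_mul, Measure.integral_comp_div, hφ.integral_eq_one, abs_of_pos hε]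
  simp [hε.ne']

end IsNonnegMollifier

/-- Reflecting the convolution variable turns the Heaviside factor into the indicator of a
half-line. Monotonicity and the bounds 0 and 1 are then read off from the density. -/
theorem regHeaviside_eq_integral_Iic (φ : ℝ → ℝ) (ε t : ℝ) :
    regHeaviside φ ε t = ∫ s in Iic t, scaledMollifier φ ε s := by
  rw [← integral_indicator measurableSet_Iic, regHeaviside, convolution_def,
    ← integral_sub_left_eq_self _ volume t]
  refine integral_congr_ae (Eventually.of_forall fun s => ?_)
  by_cases h : s ≤ t <;> simp [heavisideFn, h]

section RegHeaviside

variable {φ : ℝ → ℝ} {ε : ℝ}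

theorem hasDerivAt_regHeaviside (hφ : IsNonnegMollifier φ) (hε : 0 < ε) (t : ℝ) :
    HasDerivAt (regHeaviside φ ε) (scaledMollifier φ ε t) t := by
  have hi := hφ.integrable_scaledMollifier hε
  have hc := hφ.continuous_scaledMollifier (ε := ε)
  have e : regHeaviside φ ε = fun t => (∫ s in Iic 0, scaledMollifier φ ε s) +
      ∫ s in (0 : ℝ)..t, scaledMollifier φ ε s := by
    funext t
    rw [regHeaviside_eq_integral_Iic,
      ← intervalIntegral.integral_Iic_sub_Iic hi.integrableOn hi.integrableOn]
    ring
  rw [e]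
  exact (intervalIntegral.integral_hasDerivAt_right (hc.intervalIntegrable _ _)
    (hc.stronglyMeasurableAtFilter _ _) hc.continuousAt).const_add _

theorem regHeaviside_nonneg (hφ : IsNonnegMollifier φ) (hε : 0 < ε) (t : ℝ) :
    0 ≤ regHeaviside φ ε t := by
  rw [regHeaviside_eq_integral_Iic]
  exact integral_nonneg fun s => hφ.scaledMollifier_nonneg hε s

theorem regHeaviside_le_one (hφ : IsNonnegMollifier φ) (hε : 0 < ε) (t : ℝ) :
    regHeaviside φ ε t ≤ 1 := by
  rw [regHeaviside_eq_integral_Iic, ← hφ.integral_scaledMollifier hε]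
  exact setIntegral_le_integral (hφ.integrable_scaledMollifier hε)
    (Eventually.of_forall fun s => hφ.scaledMollifier_nonneg hε s)

end RegHeaviside

/-! ### Reduction to real solutions and conclusion -/

/-- A real linear functional of the difference of two solutions of the Cauchy problem vanishes. -/
theorem IsRegularisedSolution.apply_sub_eq_zero {T : ℝ} (hT : 0 < T) {φ : ℝ → ℝ}
    (hφ : IsNonnegMollifier φ) {ε : ℝ} (hε : 0 < ε) {g₀ g₁ : ℝ → ℂ} {u v : ℝ → ℝ → ℂ}
    (hu : IsRegularisedSolution T φ ε g₀ g₁ u) (hv : IsRegularisedSolution T φ ε g₀ g₁ v)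
    (l : ℂ →L[ℝ] ℝ) {t : ℝ} (ht : t ∈ Icc 0 T) (x : ℝ) : l (v t x - u t x) = 0 := by
  have htime : ∀ {w : ℝ → ℝ → ℂ},
      ContDiffOn ℝ 2 (fun p : ℝ × ℝ => w p.1 p.2) (Icc 0 T ×ˢ univ) → ∀ x,
        ContDiffOn ℝ 2 (fun s => w s x) (Icc 0 T) := fun hw x =>
    hw.comp (f := fun s : ℝ => (s, x)) (by fun_prop) fun s hs => ⟨hs, mem_univ _⟩
  have hspace : ∀ {w : ℝ → ℝ → ℂ},
      ContDiffOn ℝ 2 (fun p : ℝ × ℝ => w p.1 p.2) (Icc 0 T ×ˢ univ) → ∀ t ∈ Icc 0 T,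
        ContDiff ℝ 2 (w t) := fun {w} hw t ht => by
    rw [← contDiffOn_univ]
    exact hw.comp (f := fun y : ℝ => (t, y)) (by fun_prop) fun s _ => ⟨ht, mem_univ _⟩
  have hun := uniqueDiffOn_Icc hT
  have h0 : (0 : ℝ) ∈ Icc 0 T := ⟨le_rfl, hT.le⟩
  refine strip_wave_eq_zero hT (a := fun t => regHeaviside φ ε (t - 1))
    (a' := fun t => scaledMollifier φ ε (t - 1)) (w := fun t x => l (v t x - u t x))
    (fun t => (hasDerivAt_regHeaviside hφ hε (t - 1)).comp_sub_const t 1)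
    (hφ.continuous_scaledMollifier.comp (by fun_prop))
    (fun t => hφ.scaledMollifier_nonneg hε _) (fun t => regHeaviside_nonneg hφ hε _)
    (fun t => regHeaviside_le_one hφ hε _) (l.contDiff.comp_contDiffOn
      (hv.contDiffOn.sub hu.contDiffOn)) (fun s hs y => ?_) (fun y => ?_) (fun y => ?_) ht
  · have cv := htime hv.contDiffOn y
    have cu := htime hu.contDiffOn y
    have dv := hspace hv.contDiffOn s hs
    have du := hspace hu.contDiffOn s hs
    have e1 : iteratedDerivWithin 2 (fun r => l (v r y - u r y)) (Icc 0 T) s =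
        l (iteratedDerivWithin 2 (fun r => v r y) (Icc 0 T) s -
          iteratedDerivWithin 2 (fun r => u r y) (Icc 0 T) s) := by
      rw [← iteratedDerivWithin_sub hs hun (cv s hs) (cu s hs)]
      -- One-dimensional iterated derivatives are the multilinear ones evaluated at the all-ones
      -- vector, and the latter commute with `l`.
      exact congrArg (fun A => A fun _ => 1)
        (l.iteratedFDerivWithin_comp_left ((cv.sub cu) s hs) hun hs (i := 2) le_rfl)
    have e2 : iteratedDeriv 2 (fun r => l (v s r - u s r)) y =
        l (iteratedDeriv 2 (v s) y - iteratedDeriv 2 (u s) y) := by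
      rw [← iteratedDeriv_fun_sub dv.contDiffAt du.contDiffAt]
      exact congrArg (fun A => A fun _ => 1)
        (l.iteratedFDeriv_comp_left ((dv.sub du).contDiffAt (x := y)) (i := 2) le_rfl)
    rw [e1, e2, sub_eq_zero.1 (hv.equation s hs y), sub_eq_zero.1 (hu.equation s hs y), ← mul_sub,
      ← Complex.real_smul, map_smul, smul_eq_mul]
  · rw [hv.initial, hu.initial, sub_self, map_zero]
  · have cv := ((htime hv.contDiffOn y).differentiableOn (by norm_num) 0 h0).hasDerivWithinAt
    have cu := ((htime hu.contDiffOn y).differentiableOn (by norm_num) 0 h0).hasDerivWithinAt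
    have cl : HasDerivWithinAt (fun s => l (v s y - u s y)) _ (Icc 0 T) 0 :=
      l.hasFDerivAt.comp_hasDerivWithinAt 0 (cv.sub cu)
    rw [cl.derivWithin (hun 0 h0), hv.initial_deriv, hu.initial_deriv, sub_self, map_zero]

theorem mainTheorem8 (T : ℝ) (hT : 0 < T) :
    ∃ C : ℝ, 0 < C ∧
      ∀ φ : ℝ → ℝ, IsNonnegMollifier φ →
      ∀ g₀ g₁ : ℝ → ℂ, ContDiff ℝ ∞ g₀ → HasCompactSupport g₀ →
        ContDiff ℝ ∞ g₁ → HasCompactSupport g₁ →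
      ∀ ε : ℝ, 0 < ε → ε ≤ 1 →
        ∃ u : ℝ → ℝ → ℂ, IsRegularisedSolution T φ ε g₀ g₁ u ∧
          (∀ v : ℝ → ℝ → ℂ, IsRegularisedSolution T φ ε g₀ g₁ v →
            ∀ t ∈ Set.Icc 0 T, ∀ x : ℝ, v t x = u t x) ∧
          ∀ τ ∈ Set.Icc 0 T,
            sobolevNormSq 2 (u τ) ≤
              ENNReal.ofReal C * (sobolevNormSq 5 g₀ + sobolevNormSq 4 g₁) := by
  -- The exponential is the growth of the energy over [0, T]; the 2 comes from overlapping
  -- derivative orders in the Sobolev sums.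
  refine ⟨2 * Real.exp T, by positivity, fun φ hφ g₀ g₁ hg₀ hs₀ hg₁ hs₁ ε hε _ => ?_⟩
  obtain ⟨u, hu, hpde, hu0, hu1, hbd⟩ := exists_wave_solution
    (a := fun t => regHeaviside φ ε (t - 1)) (a' := fun t => scaledMollifier φ ε (t - 1))
    (fun t => (hasDerivAt_regHeaviside hφ hε (t - 1)).comp_sub_const t 1)
    (fun t => hφ.scaledMollifier_nonneg hε _) (fun t => regHeaviside_nonneg hφ hε _)
    (fun t => regHeaviside_le_one hφ hε _) hg₀ hs₀ hg₁ hs₁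
  have hun := uniqueDiffOn_Icc hT
  have htime : ∀ x, ContDiff ℝ 2 fun s => u s x := fun x =>
    hu.comp (f := fun s : ℝ => (s, x)) (by fun_prop)
  have hsol : IsRegularisedSolution T φ ε g₀ g₁ u := by
    refine ⟨hu.contDiffOn, fun t ht x => ?_, hu0, fun x => ?_⟩
    · rw [iteratedDerivWithin_eq_iteratedDeriv hun (htime x).contDiffAt ht, hpde, sub_self]
    · rw [((htime x).differentiable (by norm_num) 0).derivWithin (hun 0 ⟨le_rfl, hT.le⟩), hu1]
  refine ⟨u, hsol, fun v hv t ht x => ?_, fun τ hτ => (hbd τ).trans ?_⟩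
  · refine sub_eq_zero.1 (Complex.ext ?_ ?_)
    · exact hsol.apply_sub_eq_zero hT hφ hε hv Complex.reCLM ht x
    · exact hsol.apply_sub_eq_zero hT hφ hε hv Complex.imCLM ht x
  · gcongr
    rw [abs_of_nonneg hτ.1]
    exact hτ.2
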